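/- Conventions. A real form of a finite-dimensional complex vector space $E$ is a real subspace $W\subset E$ with $E=W\oplus iW$; its conjugation map is $x+iy\mapsto x-iy$ ($x,y\in W$). Two real forms are compatible if their conjugation maps commute. Given a complex bilinear form $B$ on $E$, a real subspace $W$ is a real slice of $(E,B)$ if $B|_W$ is real valued and nondegenerate. A triple $(W,\tilde W,C)$ of pairwise compatible real forms of $E$ is a compatible triple if all three are real slices of $(E,B)$ and $B$ is positive definite on $C$. Let $G^{\mathbb C}$ be a complex Lie group with Lie algebra $\mathfrak g^{\mathbb C}$ and identity component $G^{\mathbb C}_0$. A subgroup $H\subset G^{\mathbb C}$ is a real form of $G^{\mathbb C}$ with Lie algebra $\mathfrak h$ if $\mathfrak h=\{X\in\mathfrak g^{\mathbb C} : \exp(tX)\in H\ \forall t\in\mathbb R\}$ is a real form of $\mathfrak g^{\mathbb C}$ and $G^{\mathbb C}=H\,G^{\mathbb C}_0$. For a Hermitian inner product $\langle-,-\rangle$ on a complex vector space $E$ on which $G^{\mathbb C}$ acts linearly, with $\|v\|^2=\langle v,v\rangle$, and for $H\subset G^{\mathbb C}$ and $W\subset E$, put $\mathcal M(H,W)=\{v\in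 W : \|h\cdot v\|\ge\|v\|\ \forall h\in H\}$. Proposition. Let $G^{\mathbb C}$ be a (Hausdorff, finite-dimensional) complex Lie group with Killing form $\kappa$ on $\mathfrak g^{\mathbb C}$, and let $G,\tilde G,U$ be real forms of $G^{\mathbb C}$ with Lie algebras $\mathfrak g,\tilde{\mathfrak g},\mathfrak u$, where $U$ is compact. Assume that $(\mathfrak g,\tilde{\mathfrak g},\mathfrak u)$ is a compatible triple of real forms of $(\mathfrak g^{\mathbb C},-\kappa)$ (so that $\mathfrak g^{\mathbb C}$ is semisimple). Let $\rho^{\mathbb C}:G^{\mathbb C}\to GL(V^{\mathbb C})$ be a finite-dimensional holomorphic representation, and let $V,\tilde V$ be compatible real forms of $V^{\mathbb C}$ such that $\rho^{\mathbb C}(G)V\subset V$ and $\rho^{\mathbb C}(\tilde G)\tilde V\subset\tilde V$. Then there is a $U$-invariant Hermitian inner product on $V^{\mathbb C}$ that is real valued on $V\times V$ and on $\tilde V\times\tilde V$. Moreover, with respect to every such inner product, $$\mathcal M(G,V)\subset\mathcal M(G^{\mathbb C},V^{\mathbb C})\quad\text{and}\quad \mathcal M(\tilde G,\tilde V)\subset\mathcal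 M(G^{\mathbb C},V^{\mathbb C}).$$ -/

import Mathlib

open scoped Manifold ContDiff

noncomputable section

namespace CompatibleForms

section LinearAlgebra

variable {E : Type*} [AddCommGroup E] [Module ℂ E]

/-- Multiplication by the imaginary unit, as a real-linear map. -/
def complexStructure (E : Type*) [AddCommGroup E] [Module ℂ E] : E →ₗ[ℝ] E :=
  (LinearMap.lsmul ℂ E Complex.I).restrictScalars ℝ

/-- A real subspace `W` of a complex vector space `E` is a real form if `E = W ⊕ iW`, that is, if
the canonical map from the complexification of `W` to `E` is an isomorphism. -/
def IsRealForm (W : Submodule ℝ E) : Prop :=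
  IsCompl W (W.map (complexStructure E))

/-- The conjugation map of a real form `W`: it sends `x + i y` to `x - i y` for `x, y ∈ W`
(twice the projection onto `W` along `iW`, minus the identity). -/
def conjugation {W : Submodule ℝ E} (hW : IsRealForm W) : Module.End ℝ E :=
  (2 : ℝ) • W.projection (W.map (complexStructure E)) hW - 1

theorem conjugation_add_I_smul {W : Submodule ℝ E} (hW : IsRealForm W) {x y : E}
    (hx : x ∈ W) (hy : y ∈ W) :
    conjugation hW (x + Complex.I • y) = x - Complex.I • y := by
  have hy' : Complex.I • y ∈ W.map (complexStructure E) := ⟨y, hy, rfl⟩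
  simp only [conjugation, LinearMap.sub_apply, LinearMap.smul_apply, map_add, Module.End.one_apply,
    Submodule.projection_apply_of_mem_left hW hx, Submodule.projection_apply_of_mem_right hW hy']
  module

/-- Two real forms of `E` are compatible if their conjugation maps commute. -/
def AreCompatible (W W' : Submodule ℝ E) : Prop :=
  ∃ (hW : IsRealForm W) (hW' : IsRealForm W'), Commute (conjugation hW) (conjugation hW')

/-- `W` is a real slice of `(E, B)`: the restriction of `B` to `W` is real valued and
nondegenerate. -/
def IsRealSlice (B : LinearMap.BilinForm ℂ E) (W : Submodule ℝ E) : Prop :=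
  (∀ x ∈ W, ∀ y ∈ W, (B x y).im = 0) ∧ ∀ x ∈ W, (∀ y ∈ W, B x y = 0) → x = 0

/-- A compatible triple `(W, W', C)` of real forms of `(E, B)`: all three are real slices, `C` is of
Euclidean signature, and they are pairwise compatible real forms of `E`. -/
structure IsCompatibleTriple (B : LinearMap.BilinForm ℂ E) (W W' C : Submodule ℝ E) : Prop where
  realSlice_left : IsRealSlice B W
  realSlice_right : IsRealSlice B W'
  realSlice_compact : IsRealSlice B C
  euclidean : ∀ x ∈ C, x ≠ 0 → 0 < (B x x).re
  compatible : AreCompatible W W'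
  compatible_left : AreCompatible W C
  compatible_right : AreCompatible W' C

/-- A Hermitian inner product is compatible with the real subspace `W` if it is real on `W`. -/
def IsRealOn (h : InnerProductSpace.Core ℂ E) (W : Submodule ℝ E) : Prop :=
  ∀ x ∈ W, ∀ y ∈ W, (h.inner x y).im = 0

end LinearAlgebra

section Groups

variable {E : Type*} [NormedAddCommGroup E] [NormedSpace ℂ E]
  {GC : Type*} [TopologicalSpace GC] [ChartedSpace E GC] [Group GC]

/-- `X ∈ T₁ GC` belongs to the Lie algebra of the subgroup `H` if `exp (t X) ∈ H` for all real `t`,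
that is, if `X` is the velocity at `0` of a smooth one-parameter subgroup of `GC` which takes its
values in `H`. Here `GC` is regarded as a real manifold. -/
def IsTangentToSubgroup (H : Subgroup GC) (X : GroupLieAlgebra 𝓘(ℂ, E) GC) : Prop :=
  ∃ γ : ℝ → GC, (∀ s t, γ (s + t) = γ s * γ t) ∧ (∀ t, γ t ∈ H) ∧
    ContMDiff 𝓘(ℝ, ℝ) 𝓘(ℝ, E) ∞ γ ∧
    HasMFDerivAt 𝓘(ℝ, ℝ) 𝓘(ℝ, E) γ 0 (ContinuousLinearMap.toSpanSingleton ℝ (X : E))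

/-- The subgroup `H` is a real form, with Lie algebra `h`, of the complex Lie group `GC`: `h` is a
real form of the Lie algebra of `GC`, and `GC` is the product of `H` and the identity component. -/
structure IsGroupRealForm (H : Subgroup GC)
    (h : Submodule ℝ (GroupLieAlgebra 𝓘(ℂ, E) GC)) : Prop where
  mem_iff : ∀ X, X ∈ h ↔ IsTangentToSubgroup H X
  isRealForm : IsRealForm h
  exists_mul : ∀ x : GC, ∃ a ∈ H, ∃ c ∈ connectedComponent (1 : GC), x = a * c

variable {F : Type*} [NormedAddCommGroup F] [NormedSpace ℂ F]

/-- The Hermitian inner product `h` is invariant under the action of `H` through `ρ`. -/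
def IsInvariantUnder (h : InnerProductSpace.Core ℂ F) (ρ : GC →* (F →L[ℂ] F))
    (H : Subgroup GC) : Prop :=
  ∀ u ∈ H, ∀ x y : F, h.inner (ρ u x) (ρ u y) = h.inner x y

/-- The minimal vectors in `W` for the action of `H` through `ρ`, with respect to the norm
`‖v‖ ^ 2 = ⟨v, v⟩` of `h`. -/
def minimalVectors (h : InnerProductSpace.Core ℂ F) (ρ : GC →* (F →L[ℂ] F))
    (H : Subgroup GC) (W : Submodule ℝ F) : Set F :=
  {v | v ∈ W ∧ ∀ g ∈ H, (h.inner v v).re ≤ (h.inner (ρ g v) (ρ g v)).re}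

end Groups

end CompatibleForms

end

/-! Let `s` be the image of the Lie algebra of `GC` in `End F`, and let `h` be a `U`-invariant inner
product. Then `u` acts by skew-Hermitian operators, and `s`, the image of `u ⊕ iu`, is closed under
adjoints. Since the Killing form is nondegenerate, a linear functional vanishing on brackets is
zero; hence `tr (X p) = 0` for `X ∈ s` and `p` commuting with `s`. Integrating this, each element of
the identity component acts by an operator that commutes with the commutant of `s` and has
determinant one on the image of every idempotent of that commutant
(`isUnimodularOver_of_mem_connectedComponent`).

This unimodularity takes the place of the decomposition `GC = U exp(iu)`. For `A = ρ c` with `c` in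
the identity component put `P = A* A` and `H = log P`. Conjugation by `P` preserves `s`, hence so
does the commutator with `H`. Split `H = X + Z` with `X ∈ s` and `Z` trace-orthogonal to `s`: then
`Z` is Hermitian and centralizes `s`, and determinants on its eigenspaces force `Z = 0`. So `H ∈ s`
(`IsSymmetricLog.mem_of_unimodular`), and `exp t ≥ 1 + t` gives `‖A v‖² ≥ ‖v‖² + ⟨H v, v⟩`.

Minimal vectors: since `GC` is `U` times the identity component, such `A` suffice, and it remains to
see that `⟨H v, v⟩` has real part zero. Up to `u`, which contributes nothing, `H` comes from `i (u ∩
g)`, where reality on `V` helps, and from `iu ∩ g`, where minimality under `G` makes the first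
derivative vanish (`inner_le_of_critical`).

Existence: average over `U`, then add the conjugates with respect to `V` and `V'`. The issue is that
a conjugate stays `U`-invariant, that is, that `σ R σ` is unitary for `R = ρ a`, `a ∈ U`. The
operator `σ R σ R⁻¹` is unimodular and normalizes the image of `u`, so its positive part commutes
with `s` and must be the identity (`inner_conjugateOperator`). -/

noncomputable section

namespace CompatibleForms

/-! ### Functional calculus and logarithms of Hermitian operators -/

section SymmetricCalculus

variable {F : Type*} [NormedAddCommGroup F] [InnerProductSpace ℂ F] [FiniteDimensional ℂ F]

/-- The operator `f(T)` for a symmetric operator `T` and a real function `f`. -/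
def symmetricCalculus {T : Module.End ℂ F} (hT : T.IsSymmetric) (f : ℝ → ℝ) : Module.End ℂ F :=
  (hT.eigenvectorBasis rfl).toBasis.constr ℂ fun i =>
    (f (hT.eigenvalues rfl i) : ℂ) • hT.eigenvectorBasis rfl i

variable {T : Module.End ℂ F} (hT : T.IsSymmetric) (f : ℝ → ℝ)

theorem symmetricCalculus_eigenvectorBasis (i) :
    symmetricCalculus hT f (hT.eigenvectorBasis rfl i) =
      (f (hT.eigenvalues rfl i) : ℂ) • hT.eigenvectorBasis rfl i := by
  have := (hT.eigenvectorBasis rfl).toBasis.constr_basis ℂ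
    (fun i => (f (hT.eigenvalues rfl i) : ℂ) • hT.eigenvectorBasis rfl i) i
  rwa [OrthonormalBasis.coe_toBasis] at this

theorem repr_symmetricCalculus (v : F) (i) :
    (hT.eigenvectorBasis rfl).repr (symmetricCalculus hT f v) i =
      f (hT.eigenvalues rfl i) * (hT.eigenvectorBasis rfl).repr v i := by
  set b := hT.eigenvectorBasis rfl with hb
  conv_lhs => rw [← b.sum_repr v]
  simp only [map_sum, map_smul, hb, symmetricCalculus_eigenvectorBasis]
  simp [Pi.single_apply, mul_comm]

/-- An eigenvector for `c` has nonzero coordinates only at basis vectors whose eigenvalue is `c`.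
This frees `f(T)` from the chosen eigenbasis and yields commutation with everything that commutes
with `T`. -/
theorem symmetricCalculus_apply_of_eigenvector {c : ℝ} {x : F} (hx : T x = (c : ℂ) • x) :
    symmetricCalculus hT f x = (f c : ℂ) • x := by
  apply (hT.eigenvectorBasis rfl).repr.injective
  ext i
  rw [repr_symmetricCalculus]
  have h := hT.eigenvectorBasis_apply_self_apply rfl x i
  rw [hx] at h
  simp only [map_smul, PiLp.smul_apply, smul_eq_mul] at h ⊢
  rcases mul_eq_mul_right_iff.1 h with h | h
  · have : c = hT.eigenvalues rfl i := Complex.ofReal_injective h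
    rw [this]
  · simp [h]

theorem isSymmetric_symmetricCalculus : (symmetricCalculus hT f).IsSymmetric := by
  intro x y
  rw [← (hT.eigenvectorBasis rfl).repr.inner_map_map, ← (hT.eigenvectorBasis rfl).repr.inner_map_map,
    PiLp.inner_apply, PiLp.inner_apply]
  refine Finset.sum_congr rfl fun i _ => ?_
  rw [repr_symmetricCalculus, repr_symmetricCalculus]
  simp
  ring

theorem commute_symmetricCalculus {A : Module.End ℂ F} (hA : Commute A T) :
    Commute A (symmetricCalculus hT f) := by
  refine (hT.eigenvectorBasis rfl).toBasis.ext fun i => ?_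
  simp only [OrthonormalBasis.coe_toBasis, Module.End.mul_apply,
    symmetricCalculus_eigenvectorBasis, map_smul]
  refine (symmetricCalculus_apply_of_eigenvector hT f ?_).symm
  rw [← Module.End.mul_apply, ← hA.eq, Module.End.mul_apply, hT.apply_eigenvectorBasis, map_smul]
  rfl

theorem toMatrix_symmetricCalculus :
    (symmetricCalculus hT f).toMatrix (hT.eigenvectorBasis rfl).toBasis
      (hT.eigenvectorBasis rfl).toBasis =
      Matrix.diagonal fun i => (f (hT.eigenvalues rfl i) : ℂ) := by
  ext i j
  rw [LinearMap.toMatrix_apply, OrthonormalBasis.coe_toBasis, symmetricCalculus_eigenvectorBasis,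
    Matrix.diagonal_apply]
  rw [← OrthonormalBasis.coe_toBasis, map_smul]
  simp
  grind

theorem trace_symmetricCalculus :
    LinearMap.trace ℂ F (symmetricCalculus hT f) = ∑ i, (f (hT.eigenvalues rfl i) : ℂ) := by
  rw [LinearMap.trace_eq_matrix_trace ℂ (hT.eigenvectorBasis rfl).toBasis,
    toMatrix_symmetricCalculus, Matrix.trace_diagonal]

theorem det_symmetricCalculus :
    LinearMap.det (symmetricCalculus hT f) = ∏ i, (f (hT.eigenvalues rfl i) : ℂ) := by
  rw [← LinearMap.det_toMatrix (hT.eigenvectorBasis rfl).toBasis,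
    toMatrix_symmetricCalculus, Matrix.det_diagonal]

theorem symmetricCalculus_id : symmetricCalculus hT id = T := by
  refine (hT.eigenvectorBasis rfl).toBasis.ext fun i => ?_
  simp only [OrthonormalBasis.coe_toBasis, symmetricCalculus_eigenvectorBasis,
    hT.apply_eigenvectorBasis]
  rfl

theorem symmetricCalculus_mul (g : ℝ → ℝ) :
    symmetricCalculus hT f * symmetricCalculus hT g = symmetricCalculus hT fun x => f x * g x := by
  refine (hT.eigenvectorBasis rfl).toBasis.ext fun i => ?_
  simp only [OrthonormalBasis.coe_toBasis, symmetricCalculus_eigenvectorBasis,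
    Module.End.mul_apply, map_smul, smul_smul]
  congr 1
  push_cast
  ring

theorem inner_symmetricCalculus_self (v : F) :
    (inner ℂ (symmetricCalculus hT f v) v).re =
      ∑ i, f (hT.eigenvalues rfl i) * ‖(hT.eigenvectorBasis rfl).repr v i‖ ^ 2 := by
  rw [← (hT.eigenvectorBasis rfl).repr.inner_map_map, PiLp.inner_apply, Complex.re_sum]
  refine Finset.sum_congr rfl fun i _ => ?_
  rw [repr_symmetricCalculus, RCLike.inner_apply, map_mul, Complex.conj_ofReal, mul_left_comm,
    Complex.mul_conj, Complex.normSq_eq_norm_sq, ← Complex.ofReal_mul, Complex.ofReal_re]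

/-- `H` is a symmetric logarithm of `P`: it is symmetric and `P = exp H`. -/
structure IsSymmetricLog (P H : Module.End ℂ F) : Prop where
  isSymmetric : H.IsSymmetric
  apply_eq : ∀ (c : ℝ) (x : F), H x = (c : ℂ) • x → P x = (Real.exp c : ℂ) • x

theorem isSymmetricLog_symmetricCalculus_log (hpos : ∀ x, x ≠ 0 → 0 < (inner ℂ (T x) x).re) :
    IsSymmetricLog T (symmetricCalculus hT Real.log) := by
  refine ⟨isSymmetric_symmetricCalculus hT _, fun c x hx => ?_⟩
  have hev : ∀ i, 0 < hT.eigenvalues rfl i := by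
    intro i
    have := hpos (hT.eigenvectorBasis rfl i) ((hT.eigenvectorBasis rfl).orthonormal.ne_zero i)
    rwa [hT.apply_eigenvectorBasis, inner_smul_left, inner_self_eq_norm_sq_to_K,
      (hT.eigenvectorBasis rfl).orthonormal.1 i, RCLike.conj_ofReal, RCLike.ofReal_one, one_pow,
      mul_one] at this
  apply (hT.eigenvectorBasis rfl).repr.injective
  ext i
  have h := repr_symmetricCalculus hT Real.log x i
  rw [hT.eigenvectorBasis_apply_self_apply rfl]
  rw [hx] at h
  simp only [map_smul, PiLp.smul_apply, smul_eq_mul] at h ⊢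
  rcases mul_eq_mul_right_iff.1 h with h | h
  · have : c = Real.log (hT.eigenvalues rfl i) := by exact_mod_cast h
    rw [this, Real.exp_log (hev i)]
    rfl
  · simp [h]

variable {P H : Module.End ℂ F}

theorem IsSymmetricLog.eq_symmetricCalculus (h : IsSymmetricLog P H) :
    P = symmetricCalculus h.isSymmetric Real.exp := by
  refine (h.isSymmetric.eigenvectorBasis rfl).toBasis.ext fun i => ?_
  rw [OrthonormalBasis.coe_toBasis, symmetricCalculus_eigenvectorBasis]
  exact h.apply_eq _ _ (h.isSymmetric.apply_eigenvectorBasis rfl i)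

theorem IsSymmetricLog.det_eq (h : IsSymmetricLog P H) :
    LinearMap.det P = Complex.exp (LinearMap.trace ℂ F H) := by
  have h1 := trace_symmetricCalculus h.isSymmetric id
  have h2 := det_symmetricCalculus h.isSymmetric Real.exp
  rw [symmetricCalculus_id] at h1
  rw [← h.eq_symmetricCalculus] at h2
  rw [h1, h2, Complex.exp_sum]
  simp

/-- This is `1 + t ≤ exp t` applied to each eigenvalue of `H`; it reduces a global minimum to a
first-order condition. -/
theorem IsSymmetricLog.inner_add_inner_le (h : IsSymmetricLog P H) (v : F) :
    (inner ℂ v v).re + (inner ℂ (H v) v).re ≤ (inner ℂ (P v) v).re := by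
  have h1 : (inner ℂ v v).re =
      (inner ℂ (symmetricCalculus h.isSymmetric (fun _ => 1) v) v).re := by
    congr 2
    apply (h.isSymmetric.eigenvectorBasis rfl).repr.injective
    ext i
    rw [repr_symmetricCalculus]
    simp
  have h2 := inner_symmetricCalculus_self h.isSymmetric id v
  rw [symmetricCalculus_id] at h2
  rw [h.eq_symmetricCalculus, h1, h2, inner_symmetricCalculus_self, inner_symmetricCalculus_self,
    ← Finset.sum_add_distrib]
  refine Finset.sum_le_sum fun i _ => ?_
  rw [← add_mul]
  exact mul_le_mul_of_nonneg_right (by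
    rw [add_comm]
    exact Real.add_one_le_exp _) (by positivity)

theorem IsSymmetricLog.commute (h : IsSymmetricLog P H) {A : Module.End ℂ F} (hA : Commute A H) :
    Commute A P := by
  rw [h.eq_symmetricCalculus]
  exact commute_symmetricCalculus _ _ hA

/-- Cutting a symmetric logarithm down by a commuting symmetric idempotent. -/
theorem IsSymmetricLog.mul_idempotent (h : IsSymmetricLog P H) {p : Module.End ℂ F}
    (hp : IsIdempotentElem p) (hps : p.IsSymmetric) (hpH : Commute p H) :
    IsSymmetricLog (P * p + 1 - p) (H * p) := by
  refine ⟨hps.mul_of_commute h.isSymmetric hpH |> fun h' => by rwa [hpH.eq] at h', fun c x hx => ?_⟩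
  have hpP := h.commute hpH
  have hpx : p (p x) = p x := by rw [← Module.End.mul_apply, hp.eq]
  have e1 : H (p x) = (c : ℂ) • p x := by
    have := congrArg p hx
    rwa [← Module.End.mul_apply p, ← mul_assoc, hpH.eq, mul_assoc, hp.eq, map_smul, ] at this
  have e2 : P (p x) = _ := h.apply_eq c (p x) e1
  have e3 : (c : ℂ) • p x = (c : ℂ) • x := by
    rw [← e1, ← hx]; rfl
  simp only [LinearMap.sub_apply, LinearMap.add_apply, Module.End.mul_apply, Module.End.one_apply,
    e2]
  -- For `c = 0` the term `P (p x)` is `p x`, whatever `p x` is; for `c ≠ 0` the vector `x` lies in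
  -- the image of `p`.
  by_cases hc : c = 0
  · simp [hc]
  · have : p x = x := by
      have hc' : (c : ℂ) ≠ 0 := by exact_mod_cast hc
      exact smul_right_injective F hc' e3
    rw [this]; abel

open Polynomial in
/-- If conjugation by `exp H` preserves a space of operators then so does the commutator with the
symmetric operator `H`. -/
theorem IsSymmetricLog.commutator_mem (h : IsSymmetricLog P H) {s : Submodule ℂ (Module.End ℂ F)}
    (hs : ∀ Y ∈ s, ∃ Y' ∈ s, P * Y = Y' * P) {Y : Module.End ℂ F} (hY : Y ∈ s) :
    H * Y - Y * H ∈ s := by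
  have hH := h.isSymmetric
  set b := hH.eigenvectorBasis rfl with hb
  set l := hH.eigenvalues rfl with hl
  set Q := symmetricCalculus hH fun x => Real.exp (-x) with hQ
  have hPQ : P * Q = 1 := by
    rw [h.eq_symmetricCalculus, hQ, symmetricCalculus_mul]
    refine b.toBasis.ext fun i => ?_
    rw [OrthonormalBasis.coe_toBasis, hb, symmetricCalculus_eigenvectorBasis, ← Real.exp_add]
    simp
  let Ad : Module.End ℂ (Module.End ℂ F) := LinearMap.mulLeft ℂ P ∘ₗ LinearMap.mulRight ℂ Q
  have hAd : ∀ T, Ad T = P * (T * Q) := fun _ => rfl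
  have hAds : ∀ Y ∈ s, Ad Y ∈ s := by
    intro Y hY
    obtain ⟨Y', hY', e⟩ := hs Y hY
    rwa [hAd, ← mul_assoc, e, mul_assoc, hPQ, mul_one]
  have hPs : ∀ x y, inner ℂ x (P y) = inner ℂ (P x) y := by
    intro x y
    rw [h.eq_symmetricCalculus, isSymmetric_symmetricCalculus]
  -- In the eigenbasis of `H`, conjugation by `P` scales the `(i, j)` entry by `exp (l i - l j)`,
  -- whereas the commutator with `H` scales it by `l i - l j`.
  have entry : ∀ T i j, inner ℂ (b i) (Ad T (b j)) =
      ((Real.exp (l i - l j) : ℝ) : ℂ) * inner ℂ (b i) (T (b j)) := by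
    intro T i j
    rw [hAd, Module.End.mul_apply, Module.End.mul_apply, hPs, hQ, hb,
      symmetricCalculus_eigenvectorBasis, h.eq_symmetricCalculus,
      symmetricCalculus_eigenvectorBasis, map_smul, inner_smul_left, inner_smul_right,
      sub_eq_add_neg, Real.exp_add, Complex.conj_ofReal]
    push_cast
    ring
  have entry_pow : ∀ (n : ℕ) T i j, inner ℂ (b i) ((Ad ^ n) T (b j)) =
      ((Real.exp (l i - l j) : ℝ) : ℂ) ^ n * inner ℂ (b i) (T (b j)) := by
    intro n
    induction n with
    | zero => simp
    | succ n ih =>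
      intro T i j
      rw [pow_succ', Module.End.mul_apply, entry, ih]
      ring
  have entry_poly : ∀ (q : ℂ[X]) T i j, inner ℂ (b i) ((aeval Ad q) T (b j)) =
      q.eval ((Real.exp (l i - l j) : ℝ) : ℂ) * inner ℂ (b i) (T (b j)) := by
    intro q T i j
    induction q using Polynomial.induction_on' with
    | add p q hp hq =>
      rw [map_add, LinearMap.add_apply, LinearMap.add_apply, inner_add_right, hp, hq, eval_add,
        add_mul]
    | monomial n a =>
      rw [aeval_monomial, Algebra.algebraMap_eq_smul_one, smul_mul_assoc, one_mul,
        LinearMap.smul_apply, LinearMap.smul_apply, inner_smul_right, entry_pow, eval_monomial]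
      ring
  have mem_poly : ∀ q : ℂ[X], (aeval Ad q) Y ∈ s := by
    intro q
    induction q using Polynomial.induction_on' with
    | add p q hp hq =>
      rw [map_add]
      exact s.add_mem hp hq
    | monomial n a =>
      rw [aeval_monomial, Algebra.algebraMap_eq_smul_one, smul_mul_assoc, one_mul]
      refine s.smul_mem _ ?_
      induction n with
      | zero => simpa
      | succ n ih =>
        rw [pow_succ', Module.End.mul_apply]
        exact hAds _ ih
  let S : Finset ℂ := Finset.univ.image fun ij : _ × _ => ((Real.exp (l ij.1 - l ij.2) : ℝ) : ℂ)
  -- `q` agrees with the logarithm at every eigenvalue of `Ad`, so `q(Ad)` is the commutator with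
  -- `H`; polynomials in `Ad` preserve `s`.
  let q : ℂ[X] := Lagrange.interpolate S id fun x => ((Real.log x.re : ℝ) : ℂ)
  have hq : ∀ i j, q.eval ((Real.exp (l i - l j) : ℝ) : ℂ) = ((l i - l j : ℝ) : ℂ) := by
    intro i j
    have hmem : ((Real.exp (l i - l j) : ℝ) : ℂ) ∈ S :=
      Finset.mem_image.2 ⟨(i, j), Finset.mem_univ _, rfl⟩
    have := Lagrange.eval_interpolate_at_node (v := id)
      (fun x : ℂ => ((Real.log x.re : ℝ) : ℂ)) (Set.injOn_id _) hmem
    simpa only [id, Complex.ofReal_re, Real.log_exp] using this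
  convert mem_poly q using 1
  refine b.toBasis.ext fun j => InnerProductSpace.ext_inner_left_basis b.toBasis fun i => ?_
  rw [OrthonormalBasis.coe_toBasis, entry_poly, hq, LinearMap.sub_apply, Module.End.mul_apply,
    Module.End.mul_apply, inner_sub_right, ← hH, hb, hH.apply_eigenvectorBasis,
    hH.apply_eigenvectorBasis, map_smul, inner_smul_left, inner_smul_right]
  simp [hl]
  ring

end SymmetricCalculus

/-! ### Unimodular operators -/

/-- An operator `A` is unimodular over a space `s` of operators if it commutes with the commutant
of `s` and restricts to an operator with determinant of absolute value one on the image of every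
idempotent of this commutant. -/
structure IsUnimodularOver {F : Type*} [AddCommGroup F] [Module ℂ F]
    (s : Submodule ℂ (Module.End ℂ F)) (A : Module.End ℂ F) : Prop where
  commute : ∀ T ∈ Set.centralizer (s : Set (Module.End ℂ F)), Commute A T
  norm_det : ∀ p ∈ Set.centralizer (s : Set (Module.End ℂ F)), IsIdempotentElem p →
    ‖LinearMap.det (A * p + 1 - p)‖ = 1

/-- When `A` commutes with `p` too, `A * p + 1 - p` is `A` on the image of `p` and the identity on
its kernel, so its determinant is that of the restriction. The product formula itself needs only `B`
to commute with `p`. -/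
theorem mul_cut_mul_cut {R : Type*} [Ring R] {A B p : R} (hp : IsIdempotentElem p)
    (hB : Commute B p) : (A * p + 1 - p) * (B * p + 1 - p) = A * B * p + 1 - p := by
  have e : p * B = B * p := hB.eq.symm
  have h : p * p = p := hp
  have h1 : A * p * (B * p) = A * B * p := by
    rw [mul_assoc, ← mul_assoc p, e, mul_assoc B, h, mul_assoc]
  have h2 : p * (B * p) = B * p := by rw [← mul_assoc, e, mul_assoc, h]
  simp only [sub_mul, add_mul, mul_sub, mul_add, one_mul, mul_one, h1, h2, mul_assoc, h]
  abel

theorem IsUnimodularOver.mul {F : Type*} [AddCommGroup F] [Module ℂ F]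
    {s : Submodule ℂ (Module.End ℂ F)} {A B : Module.End ℂ F}
    (hA : IsUnimodularOver s A) (hB : IsUnimodularOver s B) : IsUnimodularOver s (A * B) := by
  refine ⟨fun T hT => (hA.commute T hT).mul_left (hB.commute T hT), fun p hp hpp => ?_⟩
  rw [← mul_cut_mul_cut hpp (hB.commute p hp), map_mul, norm_mul, hA.norm_det p hp hpp,
    hB.norm_det p hp hpp, one_mul]

/-- Conjugation by an operator `R` that normalizes `s`. -/
theorem IsUnimodularOver.conj {F : Type*} [AddCommGroup F] [Module ℂ F]
    {s : Submodule ℂ (Module.End ℂ F)} {A R R' : Module.End ℂ F} (hA : IsUnimodularOver s A)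
    (hR : R * R' = 1) (hR' : R' * R = 1) (hs : ∀ Y ∈ s, R * Y * R' ∈ s) :
    IsUnimodularOver s (R * A * R') := by
  have key : ∀ T ∈ Set.centralizer (s : Set (Module.End ℂ F)),
      R' * T * R ∈ Set.centralizer (s : Set (Module.End ℂ F)) := by
    intro T hT Y hY
    have h := hT _ (hs Y hY)
    calc Y * (R' * T * R) = (R' * R) * Y * (R' * T * R) := by rw [hR', one_mul]
      _ = R' * (R * Y * R' * T) * R := by simp only [mul_assoc]
      _ = R' * (T * (R * Y * R')) * R := by rw [h]
      _ = R' * T * R * Y * (R' * R) := by simp only [mul_assoc]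
      _ = _ := by rw [hR', mul_one]
  refine ⟨fun T hT => ?_, fun p hp hpp => ?_⟩
  · have h := (hA.commute _ (key T hT)).eq
    calc R * A * R' * T = R * A * R' * T * (R * R') := by rw [hR, mul_one]
      _ = R * (A * (R' * T * R)) * R' := by simp only [mul_assoc]
      _ = R * (R' * T * R * A) * R' := by rw [h]
      _ = R * R' * (T * (R * A * R')) := by simp only [mul_assoc]
      _ = _ := by rw [hR, one_mul]
  · have hq : IsIdempotentElem (R' * p * R) := by
      have hpp' : p * p = p := hpp
      change R' * p * R * (R' * p * R) = _
      calc R' * p * R * (R' * p * R) = R' * p * (R * R') * p * R := by simp only [mul_assoc]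
        _ = R' * (p * p) * R := by rw [hR, mul_one, mul_assoc R']
        _ = _ := by rw [hpp']
    have h := hA.norm_det _ (key p hp) hq
    have e : R * A * R' * p + 1 - p = R * (A * (R' * p * R) + 1 - R' * p * R) * R' := by
      calc R * A * R' * p + 1 - p = R * A * R' * p * (R * R') + R * R' - R * R' * p * (R * R') := by
            rw [hR, mul_one, mul_one, one_mul]
        _ = _ := by simp only [mul_add, add_mul, mul_sub, sub_mul, mul_assoc, mul_one]
    have h2 : LinearMap.det R * LinearMap.det R' = 1 := by rw [← map_mul, hR, map_one]
    rw [e, map_mul, map_mul, mul_comm, ← mul_assoc, mul_comm (LinearMap.det R'), h2, one_mul, h]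

/-! ### Polar decomposition for a space of operators closed under adjoints -/

section Adjoint

variable {F : Type*} [NormedAddCommGroup F] [InnerProductSpace ℂ F] [FiniteDimensional ℂ F]

theorem det_star (A : Module.End ℂ F) : LinearMap.det (star A) = star (LinearMap.det A) := by
  have b := stdOrthonormalBasis ℂ F
  rw [LinearMap.star_eq_adjoint, ← LinearMap.det_toMatrix b.toBasis, LinearMap.toMatrix_adjoint,
    Matrix.det_conjTranspose, LinearMap.det_toMatrix]

theorem trace_star (A : Module.End ℂ F) :
    LinearMap.trace ℂ F (star A) = star (LinearMap.trace ℂ F A) := by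
  have b := stdOrthonormalBasis ℂ F
  rw [LinearMap.star_eq_adjoint, LinearMap.trace_eq_matrix_trace ℂ b.toBasis,
    LinearMap.toMatrix_adjoint, Matrix.trace_conjTranspose, ← LinearMap.trace_eq_matrix_trace]

/-- The trace of `A A*` is the squared Hilbert-Schmidt norm. This makes the trace form nondegenerate
on any space closed under adjoints. -/
theorem eq_zero_of_trace_mul_star {A : Module.End ℂ F}
    (h : LinearMap.trace ℂ F (A * star A) = 0) : A = 0 := by
  set b := stdOrthonormalBasis ℂ F
  rw [LinearMap.trace_eq_sum_inner _ b] at h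
  have h1 : ∀ i, inner ℂ (b i) ((A * star A) (b i)) = ((‖(star A) (b i)‖ ^ 2 : ℝ) : ℂ) := by
    intro i
    rw [Module.End.mul_apply, LinearMap.star_eq_adjoint, ← LinearMap.adjoint_inner_left,
      inner_self_eq_norm_sq_to_K]
    norm_cast
  simp_rw [h1] at h
  rw [← Complex.ofReal_sum, Complex.ofReal_eq_zero,
    Finset.sum_eq_zero_iff_of_nonneg fun i _ => by positivity] at h
  rw [← star_eq_zero]
  refine b.toBasis.ext fun i => ?_
  have := h i (Finset.mem_univ i)
  simpa using this

variable {s : Submodule ℂ (Module.End ℂ F)}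

theorem star_mem_centralizer (hstar : ∀ Y ∈ s, star Y ∈ s) {T : Module.End ℂ F}
    (hT : T ∈ Set.centralizer (s : Set (Module.End ℂ F))) :
    star T ∈ Set.centralizer (s : Set (Module.End ℂ F)) := by
  intro Y hY
  have := congrArg star (hT _ (hstar Y hY))
  simpa using this.symm

theorem IsUnimodularOver.adjoint (hstar : ∀ Y ∈ s, star Y ∈ s) {A : Module.End ℂ F}
    (hA : IsUnimodularOver s A) : IsUnimodularOver s (star A) := by
  refine ⟨fun T hT => ?_, fun p hp hpp => ?_⟩
  · have := congrArg star (hA.commute _ (star_mem_centralizer hstar hT)).eq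
    simp only [star_mul, star_star] at this
    exact this.symm
  · have hp' := star_mem_centralizer hstar hp
    have h := hA.norm_det _ hp' hpp.star
    rw [← norm_star, ← det_star] at h
    rw [← h, (hA.commute _ hp').eq]
    simp

theorem IsSymmetricLog.eq_zero_of_unimodular
    (htr : ∀ X ∈ s, ∀ p ∈ Set.centralizer (s : Set (Module.End ℂ F)),
      LinearMap.trace ℂ F (X * p) = 0)
    {P H X Z : Module.End ℂ F} (hP : IsSymmetricLog P H) (hPs : IsUnimodularOver s P)
    (hH : H = X + Z) (hX : X ∈ s) (hZ : Z ∈ Set.centralizer (s : Set (Module.End ℂ F)))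
    (hZs : Z.IsSymmetric) : Z = 0 := by
  refine (hZs.eigenvectorBasis rfl).toBasis.ext fun i => ?_
  rw [OrthonormalBasis.coe_toBasis, hZs.apply_eigenvectorBasis]
  suffices h0 : hZs.eigenvalues rfl i = 0 by simp [h0]
  set c := hZs.eigenvalues rfl i with hc
  -- The spectral projection of `Z` for the eigenvalue `c`; it lies in the commutant of `s` because
  -- `Z` does.
  set p := symmetricCalculus hZs fun x => if x = c then 1 else 0 with hpdef
  have hpi : IsIdempotentElem p := by
    change p * p = p
    rw [hpdef, symmetricCalculus_mul]
    congr 1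
    ext x
    simp
  have hps : p ∈ Set.centralizer (s : Set (Module.End ℂ F)) := fun T hT =>
    commute_symmetricCalculus hZs _ (hZ T hT)
  have hpH : Commute p H := by
    rw [hH]
    exact Commute.add_right (hps X hX).symm (commute_symmetricCalculus hZs _ (Commute.refl Z)).symm
  have hlog := hP.mul_idempotent hpi (isSymmetric_symmetricCalculus hZs _) hpH
  have hdet := hPs.norm_det p hps hpi
  have htrace : LinearMap.trace ℂ F (H * p) =
      ((∑ j, (hZs.eigenvalues rfl j * if hZs.eigenvalues rfl j = c then 1 else 0) : ℝ) : ℂ) := by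
    rw [hH, add_mul, map_add, htr X hX p hps, zero_add]
    have : Z * p = symmetricCalculus hZs fun x => id x * if x = c then 1 else 0 := by
      rw [← symmetricCalculus_mul hZs id, symmetricCalculus_id]
    rw [this, trace_symmetricCalculus]
    push_cast
    rfl
  -- The component `X` has no trace on the image of `p`, so `P` has determinant `exp (c m)` there,
  -- `m` being the multiplicity of `c`. Absolute value one and `m > 0` give `c = 0`.
  rw [hlog.det_eq, htrace, Complex.norm_exp, Complex.ofReal_re, Real.exp_eq_one_iff] at hdet
  have hsum : ∀ j, (hZs.eigenvalues rfl j * if hZs.eigenvalues rfl j = c then (1 : ℝ) else 0) =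
      c * if hZs.eigenvalues rfl j = c then 1 else 0 := by
    intro j
    split_ifs with h
    · rw [h]
    · simp
  simp_rw [hsum] at hdet
  rw [← Finset.mul_sum, mul_eq_zero] at hdet
  refine hdet.resolve_right (ne_of_gt ?_)
  refine Finset.sum_pos' (fun j _ => by split_ifs <;> norm_num) ⟨i, Finset.mem_univ i, ?_⟩
  simp [hc]

/-- A positive unimodular operator that commutes with `s` is the identity. -/
theorem IsUnimodularOver.eq_one_of_mem_centralizer
    (htr : ∀ X ∈ s, ∀ p ∈ Set.centralizer (s : Set (Module.End ℂ F)),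
      LinearMap.trace ℂ F (X * p) = 0)
    {P : Module.End ℂ F} (hPs : IsUnimodularOver s P) (hsymm : P.IsSymmetric)
    (hpos : ∀ x, x ≠ 0 → 0 < (inner ℂ (P x) x).re)
    (hP : P ∈ Set.centralizer (s : Set (Module.End ℂ F))) : P = 1 := by
  have hlog := isSymmetricLog_symmetricCalculus_log hsymm hpos
  have h0 := hlog.eq_zero_of_unimodular htr hPs (zero_add _).symm s.zero_mem
    (fun T hT => commute_symmetricCalculus hsymm _ (hP T hT)) hlog.isSymmetric
  rw [h0] at hlog
  ext x
  simpa using hlog.apply_eq 0 x (by simp)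

/-- The logarithm of a positive unimodular operator that normalizes the reductive Lie algebra `s`
of operators belongs to `s`. -/
theorem IsSymmetricLog.mem_of_unimodular (hstar : ∀ Y ∈ s, star Y ∈ s)
    (hbr : ∀ X ∈ s, ∀ Y ∈ s, X * Y - Y * X ∈ s)
    (htr : ∀ X ∈ s, ∀ p ∈ Set.centralizer (s : Set (Module.End ℂ F)),
      LinearMap.trace ℂ F (X * p) = 0)
    {P H : Module.End ℂ F} (hP : IsSymmetricLog P H) (hPs : IsUnimodularOver s P)
    (hnorm : ∀ Y ∈ s, ∃ Y' ∈ s, P * Y = Y' * P) : H ∈ s := by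
  let B : LinearMap.BilinForm ℂ (Module.End ℂ F) :=
    (LinearMap.mul ℂ (Module.End ℂ F)).compr₂ (LinearMap.trace ℂ F)
  have hB : ∀ X Y, B X Y = LinearMap.trace ℂ F (X * Y) := fun _ _ => rfl
  have hrefl : B.IsRefl := fun X Y h => by rwa [hB, LinearMap.trace_mul_comm]
  have hnd : ∀ X ∈ s, (∀ Y ∈ s, LinearMap.trace ℂ F (X * Y) = 0) → X = 0 := fun X hX h =>
    eq_zero_of_trace_mul_star (h _ (hstar X hX))
  have hdisj : Disjoint s (B.orthogonal s) := by
    rw [Submodule.disjoint_def]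
    intro X hX hX'
    refine hnd X hX fun Y hY => ?_
    rw [LinearMap.trace_mul_comm]
    exact hX' Y hY
  have hcompl := (LinearMap.BilinForm.isCompl_orthogonal_iff_disjoint hrefl).2 hdisj
  obtain ⟨X, hX, Z, hZ, hXZ⟩ := Submodule.mem_sup.1
    (hcompl.sup_eq_top ▸ Submodule.mem_top : H ∈ s ⊔ B.orthogonal s)
  have hZ' : ∀ Y ∈ s, LinearMap.trace ℂ F (Y * Z) = 0 := fun Y hY => hZ Y hY
  have hZc : Z ∈ Set.centralizer (s : Set (Module.End ℂ F)) := by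
    intro Y hY
    rw [← sub_eq_zero]
    -- The commutator of `Y` and `Z` lies in `s`, since those of `Y` with `H` and with `X` do, and
    -- it is trace-orthogonal to `s` by invariance of the trace form.
    apply hnd
    · have h1 := hP.commutator_mem hnorm hY
      rw [← hXZ] at h1
      have h2 := s.sub_mem (hbr X hX Y hY) h1
      convert h2 using 1
      noncomm_ring
    · intro Y' hY'
      have h := hZ' _ (hbr Y' hY' Y hY)
      rw [sub_mul, map_sub, mul_assoc Y', LinearMap.trace_mul_comm, mul_assoc Y Y'] at h
      rw [sub_mul, map_sub, LinearMap.trace_mul_comm ℂ (Z * Y), ← mul_assoc Y',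
        LinearMap.trace_mul_comm ℂ (Y' * Z), ← h]
  have hZstar : star Z = Z := by
    have hHs : star H = H := (LinearMap.isSymmetric_iff_isSelfAdjoint H).1 hP.isSymmetric
    -- As `H` is self-adjoint, this element lies both in `s` and in its trace-orthogonal complement,
    -- so it vanishes.
    have e : X - star X = star Z - Z := by
      have : star X + star Z = X + Z := by rw [← star_add, hXZ, hHs]
      rw [sub_eq_sub_iff_add_eq_add, ← this, add_comm]
    rw [← sub_eq_zero, ← e]
    refine hnd _ (s.sub_mem hX (hstar X hX)) fun Y hY => ?_
    have h := congrArg star (hZ' _ (hstar Y hY))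
    rw [← trace_star, star_mul, star_star, star_zero] at h
    rw [e, sub_mul, map_sub, h, LinearMap.trace_mul_comm, hZ' Y hY, sub_zero]
  have h0 := hP.eq_zero_of_unimodular htr hPs hXZ.symm hX hZc
    ((LinearMap.isSymmetric_iff_isSelfAdjoint Z).2 hZstar)
  rw [← hXZ, h0, add_zero]
  exact hX

/-- Polar decomposition inside a linear group with reductive Lie algebra `s`. -/
theorem exists_symmetric_mem_inner_le (hstar : ∀ Y ∈ s, star Y ∈ s)
    (hbr : ∀ X ∈ s, ∀ Y ∈ s, X * Y - Y * X ∈ s)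
    (htr : ∀ X ∈ s, ∀ p ∈ Set.centralizer (s : Set (Module.End ℂ F)),
      LinearMap.trace ℂ F (X * p) = 0)
    {A : Module.End ℂ F} (hA : IsUnimodularOver s A) (hinj : Function.Injective A)
    (hleft : ∀ Y ∈ s, ∃ Y' ∈ s, A * Y = Y' * A) (hright : ∀ Y ∈ s, ∃ Y' ∈ s, Y * A = A * Y') :
    ∃ H ∈ s, H.IsSymmetric ∧ ∀ v : F,
      (inner ℂ v v).re + (inner ℂ (H v) v).re ≤ (inner ℂ (A v) (A v)).re := by
  have hsymm : (star A * A).IsSymmetric :=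
    (LinearMap.isSymmetric_iff_isSelfAdjoint _).2 (IsSelfAdjoint.star_mul_self A)
  have hin : ∀ v, inner ℂ ((star A * A) v) v = inner ℂ (A v) (A v) := by
    intro v
    rw [Module.End.mul_apply, LinearMap.star_eq_adjoint, LinearMap.adjoint_inner_left]
  have hpos : ∀ x, x ≠ 0 → 0 < (inner ℂ ((star A * A) x) x).re := by
    intro x hx
    rw [hin]
    exact (re_inner_self_pos (𝕜 := ℂ)).2 fun h => hx (hinj (h.trans (map_zero A).symm))
  have hlog := isSymmetricLog_symmetricCalculus_log hsymm hpos
  refine ⟨_, hlog.mem_of_unimodular hstar hbr htr ((hA.adjoint hstar).mul hA) ?_, hlog.isSymmetric,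
    fun v => ?_⟩
  · intro Y hY
    obtain ⟨Y₁, hY₁, e₁⟩ := hleft Y hY
    obtain ⟨Y₂, hY₂, e₂⟩ := hright _ (hstar Y₁ hY₁)
    refine ⟨star Y₂, hstar _ hY₂, ?_⟩
    have e₃ := congrArg star e₂
    rw [star_mul, star_mul, star_star] at e₃
    rw [mul_assoc, e₁, ← mul_assoc, e₃, mul_assoc]
  · rw [← hin]
    exact hlog.inner_add_inner_le v

/-- A unimodular operator that normalizes the skew-Hermitian part of `s` is unitary. -/
theorem IsUnimodularOver.star_mul_self_eq_one
    (hstar : ∀ Y ∈ s, star Y ∈ s)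
    (htr : ∀ X ∈ s, ∀ p ∈ Set.centralizer (s : Set (Module.End ℂ F)),
      LinearMap.trace ℂ F (X * p) = 0)
    {A : Module.End ℂ F} (hA : IsUnimodularOver s A) (hinj : Function.Injective A)
    (hleft : ∀ Y ∈ s, star Y = -Y → ∃ Y', star Y' = -Y' ∧ A * Y = Y' * A) : star A * A = 1 := by
  have hskew : ∀ Y ∈ s, star Y = -Y → Commute Y (star A * A) := by
    intro Y hY hYs
    obtain ⟨Y', hY', e⟩ := hleft Y hY hYs
    have e' := congrArg star e
    rw [star_mul, star_mul, hYs, hY', neg_mul, mul_neg, neg_inj] at e'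
    change Y * (star A * A) = star A * A * Y
    rw [← mul_assoc, e', mul_assoc, mul_assoc, e]
  refine ((hA.adjoint hstar).mul hA).eq_one_of_mem_centralizer htr
    ((LinearMap.isSymmetric_iff_isSelfAdjoint _).2 (IsSelfAdjoint.star_mul_self A)) ?_ ?_
  · intro x hx
    rw [Module.End.mul_apply, LinearMap.star_eq_adjoint, LinearMap.adjoint_inner_left]
    exact (re_inner_self_pos (𝕜 := ℂ)).2 fun h => hx (hinj (h.trans (map_zero A).symm))
  · intro Y hY
    -- `Y` is a complex combination of the skew elements `Y - Y*` and `i (Y + Y*)` of `s`.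
    have h1 := hskew _ (s.sub_mem hY (hstar Y hY)) (by simp)
    have h2 := hskew _ (s.smul_mem Complex.I (s.add_mem hY (hstar Y hY))) (by simp [add_comm])
    have h3 := h2.smul_left (-Complex.I)
    rw [smul_smul, neg_mul, Complex.I_mul_I, neg_neg, one_smul] at h3
    have h4 := (h1.add_left h3).smul_left (2⁻¹ : ℂ)
    have e : (2⁻¹ : ℂ) • (Y - star Y + (Y + star Y)) = Y := by module
    rw [e] at h4
    exact h4.eq

end Adjoint

/-! ### The derivative of a holomorphic representation -/

section Chart

variable {E : Type*} [NormedAddCommGroup E] [NormedSpace ℂ E]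
  {GC : Type*} [TopologicalSpace GC] [ChartedSpace E GC] [Group GC]
  {A : Type*} [NormedRing A] [NormedAlgebra ℂ A]

/-- A representation, read in the preferred chart at the identity. -/
def inChartAtOne (ρ : GC →* A) (y : E) : A := ρ ((chartAt E (1 : GC)).symm y)

/-- The derivative of a representation at the identity. -/
def derivativeAtOne (ρ : GC →* A) : E →L[ℂ] A :=
  fderiv ℂ (inChartAtOne ρ) (chartAt E (1 : GC) 1)

variable {ρ : GC →* A}

theorem inChartAtOne_chartAt {E : Type*} [NormedAddCommGroup E] {GC : Type*} [TopologicalSpace GC]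
    [ChartedSpace E GC] [Group GC] {A : Type*} [NormedRing A] (ρ : GC →* A) {x : GC}
    (hx : x ∈ (chartAt E (1 : GC)).source) :
    inChartAtOne (E := E) ρ (chartAt E (1 : GC) x) = ρ x := by
  rw [inChartAtOne, (chartAt E (1 : GC)).left_inv hx]

variable [LieGroup 𝓘(ℂ, E) ω GC]

theorem contDiffAt_inChartAtOne (hρ : ContMDiff 𝓘(ℂ, E) 𝓘(ℂ, A) ω ρ) {y : E}
    (hy : y ∈ (chartAt E (1 : GC)).target) : ContDiffAt ℂ ω (inChartAtOne ρ) y := by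
  have : IsManifold 𝓘(ℂ, E) ω GC := inferInstance
  rw [← contMDiffAt_iff_contDiffAt]
  exact hρ.contMDiffAt.comp y
    ((contMDiffOn_chart_symm (I := 𝓘(ℂ, E))).contMDiffAt ((chartAt E (1 : GC)).open_target.mem_nhds hy))

/-- A smooth map between open subsets of the group, read in the chart at the identity. -/
theorem differentiableAt_inChart {m : GC → GC} (hm : ContMDiff 𝓘(ℂ, E) 𝓘(ℂ, E) ω m) {y : E}
    (hy : y ∈ (chartAt E (1 : GC)).target)
    (hmy : m ((chartAt E (1 : GC)).symm y) ∈ (chartAt E (1 : GC)).source) :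
    DifferentiableAt ℂ (fun z => chartAt E (1 : GC) (m ((chartAt E (1 : GC)).symm z))) y := by
  have : IsManifold 𝓘(ℂ, E) ω GC := inferInstance
  have h : ContMDiffAt 𝓘(ℂ, E) 𝓘(ℂ, E) ω
      (fun z => chartAt E (1 : GC) (m ((chartAt E (1 : GC)).symm z))) y := by
    refine ContMDiffAt.comp (g := chartAt E (1 : GC))
      (f := fun z => m ((chartAt E (1 : GC)).symm z)) y
      ((contMDiffOn_chart (I := 𝓘(ℂ, E))).contMDiffAt
        ((chartAt E (1 : GC)).open_source.mem_nhds hmy)) ?_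
    exact hm.contMDiffAt.comp y ((contMDiffOn_chart_symm (I := 𝓘(ℂ, E))).contMDiffAt
      ((chartAt E (1 : GC)).open_target.mem_nhds hy))
  exact (contMDiffAt_iff_contDiffAt.1 h).differentiableAt (by simp)

/-- Chain rule through the chart at the identity. `L` can stay unspecified: later steps use only
that the derivative takes values in the image of `derivativeAtOne`. -/
theorem hasFDerivAt_inChartAtOne_comp (hρ : ContMDiff 𝓘(ℂ, E) 𝓘(ℂ, A) ω ρ) {m : GC → GC}
    (hm : ContMDiff 𝓘(ℂ, E) 𝓘(ℂ, E) ω m) {y : E} (hy : y ∈ (chartAt E (1 : GC)).target)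
    (hmy : m ((chartAt E (1 : GC)).symm y) = 1) :
    ∃ L : E →L[ℂ] E,
      HasFDerivAt (fun z => ρ (m ((chartAt E (1 : GC)).symm z))) (derivativeAtOne (E := E) ρ ∘L L) y := by
  have h1 : (1 : GC) ∈ (chartAt E (1 : GC)).source := mem_chart_source E 1
  have hd := differentiableAt_inChart hm hy (by rw [hmy]; exact h1)
  refine ⟨fderiv ℂ (fun z => chartAt E (1 : GC) (m ((chartAt E (1 : GC)).symm z))) y, ?_⟩
  have hr : HasFDerivAt (inChartAtOne ρ) (derivativeAtOne (E := E) ρ)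
      (chartAt E (1 : GC) (m ((chartAt E (1 : GC)).symm y))) := by
    rw [hmy]
    exact ((contDiffAt_inChartAtOne hρ ((chartAt E (1 : GC)).map_source h1)).differentiableAt
      (by simp)).hasFDerivAt
  refine (hr.comp y hd.hasFDerivAt).congr_of_eventuallyEq ?_
  have hc : ContinuousAt (fun z => m ((chartAt E (1 : GC)).symm z)) y :=
    hm.continuous.continuousAt.comp ((chartAt E (1 : GC)).continuousAt_symm hy)
  have hmem : (chartAt E (1 : GC)).source ∈ nhds (m ((chartAt E (1 : GC)).symm y)) := by
    rw [hmy]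
    exact (chartAt E (1 : GC)).open_source.mem_nhds h1
  filter_upwards [hc.preimage_mem_nhds hmem] with z hz
  exact (inChartAtOne_chartAt ρ hz).symm

/-- The derivative of a representation at any point, in the chart at the identity. -/
theorem hasFDerivAt_inChartAtOne (hρ : ContMDiff 𝓘(ℂ, E) 𝓘(ℂ, A) ω ρ) {y : E}
    (hy : y ∈ (chartAt E (1 : GC)).target) :
    ∃ L : E →L[ℂ] E, HasFDerivAt (inChartAtOne ρ)
      (inChartAtOne ρ y • (derivativeAtOne (E := E) ρ ∘L L)) y := by
  set x := (chartAt E (1 : GC)).symm y with hx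
  obtain ⟨L, hL⟩ := hasFDerivAt_inChartAtOne_comp hρ (m := fun z => x⁻¹ * z)
    (contMDiff_mul_left (I := 𝓘(ℂ, E)) (n := ω)) hy (inv_mul_cancel x)
  refine ⟨L, ?_⟩
  convert hL.const_mul (ρ x) using 1
  · ext z
    rw [← map_mul, mul_inv_cancel_left]
    rfl
  · rfl

/-- The image of the derivative of a representation is invariant under conjugation. -/
theorem conj_derivativeAtOne (hρ : ContMDiff 𝓘(ℂ, E) 𝓘(ℂ, A) ω ρ) (g : GC) (X : E) :
    ∃ Y : E, ρ g * derivativeAtOne (E := E) ρ X * ρ g⁻¹ = derivativeAtOne (E := E) ρ Y := by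
  have h1 : (1 : GC) ∈ (chartAt E (1 : GC)).source := mem_chart_source E 1
  have ht := (chartAt E (1 : GC)).map_source h1
  obtain ⟨L, hL⟩ := hasFDerivAt_inChartAtOne_comp hρ (m := fun z => g * z * g⁻¹)
    ((contMDiff_mul_right (I := 𝓘(ℂ, E)) (n := ω)).comp
      (contMDiff_mul_left (I := 𝓘(ℂ, E)) (n := ω))) ht
    (by rw [(chartAt E (1 : GC)).left_inv h1]; group)
  have h2 := (((contDiffAt_inChartAtOne hρ ht).differentiableAt
      (by simp)).hasFDerivAt.const_mul (ρ g)).mul_const' (ρ g⁻¹)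
  refine ⟨L X, ?_⟩
  have h3 : (fun z => ρ (g * (chartAt E (1 : GC)).symm z * g⁻¹)) =
      fun z => ρ g * inChartAtOne ρ z * ρ g⁻¹ := by
    ext z
    rw [map_mul, map_mul]
    rfl
  rw [h3] at hL
  exact congrArg (fun T : E →L[ℂ] A => T X) (h2.unique hL)

/-- A real one-parameter subgroup with velocity `X` is mapped to a curve with velocity given by the
derivative of the representation. -/
theorem hasDerivAt_comp_oneParameter (hρ : ContMDiff 𝓘(ℂ, E) 𝓘(ℂ, A) ω ρ) {γ : ℝ → GC}
    (h0 : γ 0 = 1) {X : E}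
    (hγ : HasMFDerivAt 𝓘(ℝ, ℝ) 𝓘(ℝ, E) γ 0 (ContinuousLinearMap.toSpanSingleton ℝ X)) :
    HasDerivAt (fun t => ρ (γ t)) (derivativeAtOne (E := E) ρ X) 0 := by
  have h1 : (1 : GC) ∈ (chartAt E (1 : GC)).source := mem_chart_source E 1
  have ht := (chartAt E (1 : GC)).map_source h1
  have hd := hγ.2
  simp only [writtenInExtChartAt, extChartAt, h0, mfld_simps] at hd
  have hd' : HasDerivAt (fun t => chartAt E (1 : GC) (γ t)) X 0 := by
    rw [hasDerivAt_iff_hasFDerivAt]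
    exact hasFDerivWithinAt_univ.1 hd
  have h2 : HasFDerivAt (inChartAtOne ρ) ((derivativeAtOne (E := E) ρ).restrictScalars ℝ)
      (chartAt E (1 : GC) (γ 0)) := by
    rw [h0]
    exact ((contDiffAt_inChartAtOne hρ ht).differentiableAt
      (by simp)).hasFDerivAt.restrictScalars ℝ
  refine (h2.comp_hasDerivAt 0 hd').congr_of_eventuallyEq ?_
  have hmem : (chartAt E (1 : GC)).source ∈ nhds (γ 0) := by
    rw [h0]
    exact (chartAt E (1 : GC)).open_source.mem_nhds h1
  filter_upwards [hγ.1.preimage_mem_nhds hmem] with z hz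
  exact (inChartAtOne_chartAt ρ hz).symm

/-- Differentiate `ρ (x z) = ρ x ρ z` at `z = 1`. A left-invariant field thus acts on `ρ` as right
multiplication by a constant operator, which is what makes brackets computable. -/
theorem mfderiv_mulInvariantVectorField (hρ : ContMDiff 𝓘(ℂ, E) 𝓘(ℂ, A) ω ρ)
    (X : GroupLieAlgebra 𝓘(ℂ, E) GC) (x : GC) :
    mfderiv 𝓘(ℂ, E) 𝓘(ℂ, A) ρ x (mulInvariantVectorField X x) =
      ρ x * derivativeAtOne (E := E) ρ X := by
  have h1 : (1 : GC) ∈ (chartAt E (1 : GC)).source := mem_chart_source E 1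
  have ht := (chartAt E (1 : GC)).map_source h1
  have hm : MDifferentiableAt 𝓘(ℂ, E) 𝓘(ℂ, E) (x * ·) (1 : GC) :=
    (contMDiff_mul_left (I := 𝓘(ℂ, E)) (n := ω)).mdifferentiableAt (by simp)
  have hρx : MDifferentiableAt 𝓘(ℂ, E) 𝓘(ℂ, A) ρ (x * 1) := hρ.mdifferentiableAt (by simp)
  have hc := hρx.hasMFDerivAt.comp 1 hm.hasMFDerivAt
  obtain ⟨L, hL, hLX⟩ : ∃ L : E →L[ℂ] A, HasFDerivAt (fun z => ρ (x * (chartAt E (1 : GC)).symm z))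
      L (chartAt E (1 : GC) 1) ∧
      L X = mfderiv 𝓘(ℂ, E) 𝓘(ℂ, A) ρ (x * 1) (mulInvariantVectorField X x) := by
    have := hc.2
    simp only [writtenInExtChartAt, extChartAt, mfld_simps] at this
    exact ⟨_, hasFDerivWithinAt_univ.1 this, rfl⟩
  have h3 : (fun z => ρ (x * (chartAt E (1 : GC)).symm z)) = fun z => ρ x * inChartAtOne ρ z := by
    ext z
    rw [map_mul]
    rfl
  rw [h3] at hL
  have h4 := ((contDiffAt_inChartAtOne hρ ht).differentiableAt
      (by simp)).hasFDerivAt.const_mul (ρ x)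
  rw [hL.unique h4, mul_one] at hLX
  exact hLX.symm

open VectorField in
/-- The derivative of a representation respects brackets. -/
theorem derivativeAtOne_lie [FiniteDimensional ℂ E] (hρ : ContMDiff 𝓘(ℂ, E) 𝓘(ℂ, A) ω ρ)
    (X Y : GroupLieAlgebra 𝓘(ℂ, E) GC) :
    derivativeAtOne (E := E) ρ (⁅X, Y⁆ : GroupLieAlgebra 𝓘(ℂ, E) GC) =
      derivativeAtOne (E := E) ρ X * derivativeAtOne (E := E) ρ Y -
      derivativeAtOne (E := E) ρ Y * derivativeAtOne (E := E) ρ X := by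
  have h1 : (1 : GC) ∈ (chartAt E (1 : GC)).source := mem_chart_source E 1
  have ht := (chartAt E (1 : GC)).map_source h1
  have hcomp : CompleteSpace E := FiniteDimensional.complete ℂ E
  set y₀ := chartAt E (1 : GC) 1 with hy₀
  set r : E → A := inChartAtOne ρ with hr
  let vf : E → E → E := fun X =>
    mpullbackWithin 𝓘(ℂ, E) 𝓘(ℂ, E) (extChartAt 𝓘(ℂ, E) (1 : GC)).symm
      (mulInvariantVectorField (X : GroupLieAlgebra 𝓘(ℂ, E) GC)) (Set.range 𝓘(ℂ, E))
  have hset : (extChartAt 𝓘(ℂ, E) (1 : GC)).symm ⁻¹' Set.univ ∩ Set.range 𝓘(ℂ, E) = Set.univ := by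
    simp
  have hvf : ∀ X, DifferentiableAt ℂ (vf X) y₀ := by
    intro X
    have h := (mdifferentiableAt_mulInvariantVectorField (I := 𝓘(ℂ, E)) (G := GC)
      X (g := (1 : GC))).mdifferentiableWithinAt (s := Set.univ)
    have h' := h.differentiableWithinAt_mpullbackWithin_vectorField
    rw [hset] at h'
    exact differentiableWithinAt_univ.1 h'
  have hrvf : ∀ X, ∀ y ∈ (chartAt E (1 : GC)).target,
      fderiv ℂ r y (vf X y) = r y * derivativeAtOne (E := E) ρ X := by
    intro X y hy
    have hy' : y ∈ (extChartAt 𝓘(ℂ, E) (1 : GC)).target := by simpa [extChartAt] using hy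
    have hinv := isInvertible_mfderivWithin_extChartAt_symm (I := 𝓘(ℂ, E)) (x := (1 : GC)) hy'
    have e1 : mfderivWithin 𝓘(ℂ, E) 𝓘(ℂ, E) (extChartAt 𝓘(ℂ, E) (1 : GC)).symm
        (Set.range 𝓘(ℂ, E)) y (vf X y) =
        mulInvariantVectorField (X : GroupLieAlgebra 𝓘(ℂ, E) GC) _ :=
      hinv.self_apply_inverse _
    have hs : MDifferentiableAt 𝓘(ℂ, E) 𝓘(ℂ, E) (extChartAt 𝓘(ℂ, E) (1 : GC)).symm y := by
      have := mdifferentiableWithinAt_extChartAt_symm hy'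
      rwa [ModelWithCorners.range_eq_univ, mdifferentiableWithinAt_univ] at this
    have hc := (hρ.mdifferentiableAt (by simp)).hasMFDerivAt.comp y hs.hasMFDerivAt
    have e2 := hasMFDerivAt_iff_hasFDerivAt.1 hc
    have e3 : fderiv ℂ r y = _ := HasFDerivAt.fderiv e2
    rw [e3]
    have e4 := mfderiv_mulInvariantVectorField hρ X ((extChartAt 𝓘(ℂ, E) (1 : GC)).symm y)
    rw [← e1] at e4
    simp only [ModelWithCorners.range_eq_univ, mfderivWithin_univ] at e4
    exact e4
  have hinv : ∀ (L : E →L[ℂ] E), L = ContinuousLinearMap.id ℂ E → ∀ v, L.inverse v = v := by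
    rintro _ rfl v
    rw [ContinuousLinearMap.inverse_id]
    rfl
  have hbr : (⁅X, Y⁆ : GroupLieAlgebra 𝓘(ℂ, E) GC) = lieBracket ℂ (vf X) (vf Y) y₀ := by
    rw [GroupLieAlgebra.bracket_def, ← mlieBracketWithin_univ, mlieBracketWithin_apply]
    refine (hinv _ mfderiv_extChartAt_self _).trans ?_
    rw [hset]
    exact congrFun lieBracketWithin_univ _
  have hr2 : ContDiffAt ℂ ω r y₀ := contDiffAt_inChartAtOne hρ ht
  have hr0 : r y₀ = 1 := by
    rw [hr, hy₀, inChartAtOne_chartAt ρ h1, map_one]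
  have hr1 : ∀ X, fderiv ℂ r y₀ (vf X y₀) = derivativeAtOne (E := E) ρ X := by
    intro X
    rw [hrvf X y₀ ht, hr0, one_mul]
  have key : ∀ X W, fderiv ℂ (fun y => fderiv ℂ r y (vf X y)) y₀ (vf W y₀) =
      derivativeAtOne (E := E) ρ W * derivativeAtOne (E := E) ρ X := by
    intro X W
    have e3 : (fun y => fderiv ℂ r y (vf X y)) =ᶠ[nhds y₀]
        fun y => r y * derivativeAtOne (E := E) ρ X := by
      filter_upwards [(chartAt E (1 : GC)).open_target.mem_nhds ht] with y hy using hrvf X y hy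
    rw [e3.fderiv_eq, ((hr2.differentiableAt (by simp)).hasFDerivAt.mul_const' _).fderiv,
      ← hr1 W]
    rfl
  -- The second derivative of `r` is symmetric, so the derivative of `r` along a bracket is the
  -- commutator of the two iterated derivatives, both supplied by `key`.
  have := fderiv_apply_lieBracket hr2 (by simp) (hvf Y) (hvf X)
  rw [hbr]
  exact this.trans (congrArg₂ (· - ·) (key Y X) (key X Y))

end Chart

/-! ### The identity component acts by unimodular operators -/

section Component

variable {F : Type*} [NormedAddCommGroup F] [NormedSpace ℂ F] [FiniteDimensional ℂ F]

theorem differentiable_det :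
    Differentiable ℂ fun A : F →L[ℂ] F => LinearMap.det (A : Module.End ℂ F) := by
  let b := Module.finBasis ℂ F
  have e : (fun A : F →L[ℂ] F => LinearMap.det (A : Module.End ℂ F)) = fun A =>
      ∑ σ : Equiv.Perm _, Equiv.Perm.sign σ • ∏ i, b.coord (σ i) (A (b i)) := by
    ext A
    rw [← LinearMap.det_toMatrix b, Matrix.det_apply]
    simp [LinearMap.toMatrix_apply]
  have h : ∀ i j, Differentiable ℂ fun A : F →L[ℂ] F => b.coord i (A (b j)) := fun i j =>
    (LinearMap.toContinuousLinearMap (b.coord i)).differentiable.comp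
      (ContinuousLinearMap.apply ℂ F (b j)).differentiable
  rw [e]
  fun_prop

/-- Jacobi's formula in a direction `M * N`: multiplicativity of the determinant moves the
computation to the identity, with no invertibility of `M` needed. -/
theorem fderiv_det_mul (M N : F →L[ℂ] F) :
    fderiv ℂ (fun A : F →L[ℂ] F => LinearMap.det (A : Module.End ℂ F)) M (M * N) =
      LinearMap.det (M : Module.End ℂ F) * LinearMap.trace ℂ F N := by
  have h1 : HasDerivAt (fun t : ℂ => M + t • (M * N)) (M * N) 0 := by
    simpa using ((hasDerivAt_id (0 : ℂ)).smul_const (M * N)).const_add M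
  have h2 := (differentiable_det (F := F) (M + (0 : ℂ) • (M * N))).hasFDerivAt.comp_hasDerivAt
    (0 : ℂ) h1
  rw [zero_smul, add_zero] at h2
  refine h2.unique ?_
  -- Along the line, the determinant is that of `M` times `1 + t tr N + O(t²)`; the remainder is an
  -- explicit polynomial multiple of `t ^ 2`.
  let b := Module.finBasis ℂ F
  have e : (fun A : F →L[ℂ] F => LinearMap.det (A : Module.End ℂ F)) ∘
      (fun t : ℂ => M + t • (M * N)) = fun t => LinearMap.det (M : Module.End ℂ F) *
      (1 + LinearMap.trace ℂ F N * t +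
        (Matrix.det (1 + (Polynomial.X : Polynomial ℂ) • (LinearMap.toMatrix b b N).map
          Polynomial.C)).divX.divX.eval t * t ^ 2) := by
    ext t
    have : ((M + t • (M * N) : F →L[ℂ] F) : Module.End ℂ F) =
        (M : Module.End ℂ F) * (1 + t • (N : Module.End ℂ F)) := by
      ext x
      simp
    simp only [Function.comp]
    rw [this, map_mul, ← LinearMap.det_toMatrix b (1 + t • (N : Module.End ℂ F)), map_add, map_smul,
      LinearMap.toMatrix_one, Matrix.det_one_add_smul, LinearMap.trace_eq_matrix_trace ℂ b]
  rw [e]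
  set q := (Matrix.det (1 + (Polynomial.X : Polynomial ℂ) • (LinearMap.toMatrix b b N).map
    Polynomial.C)).divX.divX
  have h3 := ((hasDerivAt_id (0 : ℂ)).const_mul (LinearMap.trace ℂ F N)).const_add 1 |>.add
    ((q.hasDerivAt 0).mul ((hasDerivAt_id (0 : ℂ)).pow 2)) |>.const_mul (LinearMap.det (M : Module.End ℂ F))
  refine (h3.congr_deriv ?_).congr_of_eventuallyEq ?_
  · simp
  · exact Filter.Eventually.of_forall fun t => by simp

variable {E : Type*} [NormedAddCommGroup E] [NormedSpace ℂ E]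
  {GC : Type*} [TopologicalSpace GC] [ChartedSpace E GC] [Group GC]

/-- The derivative of a representation at the identity, as a map to linear operators. -/
def operatorRep {F : Type*} [NormedAddCommGroup F] [NormedSpace ℂ F] {E : Type*}
    [NormedAddCommGroup E] [NormedSpace ℂ E] {GC : Type*} [TopologicalSpace GC]
    [ChartedSpace E GC] [Group GC] (ρ : GC →* (F →L[ℂ] F)) :
    GroupLieAlgebra 𝓘(ℂ, E) GC →ₗ[ℂ] Module.End ℂ F :=
  ContinuousLinearMap.coeLM ℂ ∘ₗ (derivativeAtOne (E := E) ρ).toLinearMap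

/-- The Lie algebra of operators defined by a representation. -/
def operatorAlgebra {F : Type*} [NormedAddCommGroup F] [NormedSpace ℂ F] {E : Type*}
    [NormedAddCommGroup E] [NormedSpace ℂ E] {GC : Type*} [TopologicalSpace GC]
    [ChartedSpace E GC] [Group GC] (ρ : GC →* (F →L[ℂ] F)) : Submodule ℂ (Module.End ℂ F) :=
  LinearMap.range (operatorRep (E := E) ρ)

theorem derivativeAtOne_mem_operatorAlgebra {F : Type*} [NormedAddCommGroup F] [NormedSpace ℂ F]
    {E : Type*} [NormedAddCommGroup E] [NormedSpace ℂ E] {GC : Type*} [TopologicalSpace GC]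
    [ChartedSpace E GC] [Group GC] (ρ : GC →* (F →L[ℂ] F)) (X : E) :
    (derivativeAtOne (E := E) ρ X : Module.End ℂ F) ∈ operatorAlgebra (E := E) ρ :=
  ⟨X, rfl⟩

variable [LieGroup 𝓘(ℂ, E) ω GC] {ρ : GC →* (F →L[ℂ] F)}

/-- A zero derivative on an open set makes level sets open. The chart target need not be connected,
so constancy is claimed only near the identity. -/
theorem eventually_eq_of_hasFDerivAt_zero {E : Type*} [NormedAddCommGroup E] [NormedSpace ℂ E]
    {GC : Type*} [TopologicalSpace GC] [ChartedSpace E GC] [Group GC]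
    {β : Type*} [NormedAddCommGroup β] [NormedSpace ℂ β]
    {f : GC → β} (hf : ∀ y ∈ (chartAt E (1 : GC)).target,
      HasFDerivAt (fun z => f ((chartAt E (1 : GC)).symm z)) (0 : E →L[ℂ] β) y) :
    ∀ᶠ x in nhds 1, f x = f 1 := by
  let : NormedSpace ℝ E := .restrictScalars ℝ ℂ E
  have h1 : (1 : GC) ∈ (chartAt E (1 : GC)).source := mem_chart_source E 1
  have hopen := (chartAt E (1 : GC)).open_target.isOpen_inter_preimage_of_fderiv_eq_zero (𝕜 := ℂ)
    (fun y hy => (hf y hy).differentiableAt.differentiableWithinAt)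
    (fun y hy => (hf y hy).fderiv) {f 1}
  have hmem : chartAt E (1 : GC) 1 ∈ (chartAt E (1 : GC)).target ∩
      (fun z => f ((chartAt E (1 : GC)).symm z)) ⁻¹' {f 1} :=
    ⟨(chartAt E (1 : GC)).map_source h1, by simp⟩
  filter_upwards [((chartAt E (1 : GC)).continuousAt h1).preimage_mem_nhds (hopen.mem_nhds hmem),
    (chartAt E (1 : GC)).open_source.mem_nhds h1] with x hx hx'
  have := hx.2
  simpa [(chartAt E (1 : GC)).left_inv hx'] using this

theorem eventually_conj_eq (hρ : ContMDiff 𝓘(ℂ, E) 𝓘(ℂ, F →L[ℂ] F) ω ρ) (T : F →L[ℂ] F)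
    (hT : (T : Module.End ℂ F) ∈
      Set.centralizer (operatorAlgebra (E := E) ρ : Set (Module.End ℂ F))) :
    ∀ᶠ x in nhds (1 : GC), ρ x * T * ρ x⁻¹ = T := by
  have hcomp : CompleteSpace F := FiniteDimensional.complete ℂ F
  have hcomm : ∀ v, derivativeAtOne (E := E) ρ v * T = T * derivativeAtOne (E := E) ρ v := by
    intro v
    have := hT _ (derivativeAtOne_mem_operatorAlgebra ρ v)
    ext x
    exact LinearMap.congr_fun this x
  have key := eventually_eq_of_hasFDerivAt_zero (E := E) (GC := GC) (f := fun x => ρ x * T * ρ x⁻¹)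
    fun y hy => ?_
  · simpa using key
  obtain ⟨L, hL⟩ := hasFDerivAt_inChartAtOne hρ hy
  set x := (chartAt E (1 : GC)).symm y with hx
  have e1 : ρ x * ρ x⁻¹ = 1 := by rw [← map_mul, mul_inv_cancel, map_one]
  have e2 : ρ x⁻¹ * ρ x = 1 := by rw [← map_mul, inv_mul_cancel, map_one]
  have hring : ∀ z, ρ z⁻¹ = Ring.inverse (ρ z) := fun z =>
    (Ring.inverse_unit ⟨ρ z, ρ z⁻¹, by rw [← map_mul, mul_inv_cancel, map_one],
      by rw [← map_mul, inv_mul_cancel, map_one]⟩).symm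
  let w : (F →L[ℂ] F)ˣ := ⟨ρ x, ρ x⁻¹, e1, e2⟩
  have hinv := (hasFDerivAt_ringInverse (𝕜 := ℂ) w).comp (f := inChartAtOne (E := E) ρ) y hL
  have hfun : Ring.inverse ∘ inChartAtOne (E := E) ρ =
      fun z => ρ ((chartAt E (1 : GC)).symm z)⁻¹ := funext fun z => (hring _).symm
  rw [hfun] at hinv
  refine ((hL.mul_const' T).mul' hinv).congr_fderiv ?_
  ext1 v
  change ρ x * T * (-(ρ x⁻¹ * (ρ x * derivativeAtOne (E := E) ρ (L v)) * ρ x⁻¹)) +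
    (ρ x * derivativeAtOne (E := E) ρ (L v)) * T * ρ x⁻¹ = 0
  rw [← mul_assoc (ρ x⁻¹), e2, one_mul, mul_assoc (ρ x) _ T, hcomm]
  noncomm_ring

theorem eventually_det_eq_one (hρ : ContMDiff 𝓘(ℂ, E) 𝓘(ℂ, F →L[ℂ] F) ω ρ) (p : F →L[ℂ] F)
    (hp : (p : Module.End ℂ F) ∈
      Set.centralizer (operatorAlgebra (E := E) ρ : Set (Module.End ℂ F)))
    (htr : ∀ X ∈ operatorAlgebra (E := E) ρ, LinearMap.trace ℂ F (X * p) = 0)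
    (hpp : IsIdempotentElem p) :
    ∀ᶠ x in nhds (1 : GC), LinearMap.det ((ρ x * p + 1 - p : F →L[ℂ] F) : Module.End ℂ F) = 1 := by
  have hcomm : ∀ v, derivativeAtOne (E := E) ρ v * p = p * derivativeAtOne (E := E) ρ v := by
    intro v
    have := hp _ (derivativeAtOne_mem_operatorAlgebra ρ v)
    ext x
    exact LinearMap.congr_fun this x
  have key := eventually_eq_of_hasFDerivAt_zero (E := E) (GC := GC)
    (f := fun x => LinearMap.det ((ρ x * p + 1 - p : F →L[ℂ] F) : Module.End ℂ F))
    fun y hy => ?_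
  · have e : LinearMap.det ((ρ 1 * p + 1 - p : F →L[ℂ] F) : Module.End ℂ F) = 1 := by
      rw [map_one, one_mul, add_sub_cancel_left]
      exact LinearMap.det_id
    simpa only [e] using key
  obtain ⟨L, hL⟩ := hasFDerivAt_inChartAtOne hρ hy
  have h1 := ((hL.mul_const' p).add_const 1).sub_const p
  refine ((differentiable_det _).hasFDerivAt.comp y h1).congr_fderiv ?_
  ext1 v
  set r := inChartAtOne ρ y
  set S := derivativeAtOne (E := E) ρ (L v)
  have hpp' : p * p = p := hpp
  -- This puts the velocity in the form required by `fderiv_det_mul`; the derivative of the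
  -- determinant is then a multiple of `tr (S p) = 0`.
  have e : r * S * p = (r * p + 1 - p) * (S * p) := by
    have e1 : p * (S * p) = S * p := by
      rw [hcomm, ← mul_assoc, hpp']
    rw [sub_mul, add_mul, mul_assoc r p, e1, one_mul, mul_assoc, add_sub_cancel_right]
  change fderiv ℂ (fun A : F →L[ℂ] F => LinearMap.det (A : Module.End ℂ F)) (r * p + 1 - p)
    (r * S * p) = 0
  rw [e, fderiv_det_mul]
  have := htr _ (derivativeAtOne_mem_operatorAlgebra ρ (L v))
  exact mul_eq_zero_of_right _ this

/-- A subgroup that is a neighbourhood of the identity is open, hence closed. Local identities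
thereby spread to the identity component without the exponential map. -/
theorem connectedComponent_subset_of_mem_nhds {G : Type*} [Group G] [TopologicalSpace G]
    [IsTopologicalGroup G] (K : Subgroup G) (hK : (K : Set G) ∈ nhds 1) :
    connectedComponent (1 : G) ⊆ K := by
  have ho := K.isOpen_of_mem_nhds hK
  exact IsClopen.connectedComponent_subset ⟨K.isClosed_of_isOpen ho, ho⟩ K.one_mem

theorem commute_of_mem_connectedComponent (hρ : ContMDiff 𝓘(ℂ, E) 𝓘(ℂ, F →L[ℂ] F) ω ρ)
    {T : F →L[ℂ] F} (hT : (T : Module.End ℂ F) ∈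
      Set.centralizer (operatorAlgebra (E := E) ρ : Set (Module.End ℂ F)))
    {c : GC} (hc : c ∈ connectedComponent (1 : GC)) : Commute (ρ c) T := by
  have : IsTopologicalGroup GC := topologicalGroup_of_lieGroup 𝓘(ℂ, E) ω
  let K : Subgroup GC :=
    { carrier := {x | Commute (ρ x) T}
      mul_mem' := fun {a b} ha hb => by
        change Commute (ρ (a * b)) T
        rw [map_mul]
        exact Commute.mul_left ha hb
      one_mem' := by
        change Commute (ρ 1) T
        rw [map_one]
        exact Commute.one_left T
      inv_mem' := fun {a} ha => by
        have ha' : ρ a * T = T * ρ a := ha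
        change ρ a⁻¹ * T = T * ρ a⁻¹
        have e1 : ρ a * ρ a⁻¹ = 1 := by rw [← map_mul, mul_inv_cancel, map_one]
        have e2 : ρ a⁻¹ * ρ a = 1 := by rw [← map_mul, inv_mul_cancel, map_one]
        calc ρ a⁻¹ * T = ρ a⁻¹ * (T * ρ a) * ρ a⁻¹ := by rw [mul_assoc, mul_assoc T, e1, mul_one]
          _ = T * ρ a⁻¹ := by rw [← ha', ← mul_assoc, e2, one_mul] }
  refine connectedComponent_subset_of_mem_nhds K ?_ hc
  filter_upwards [eventually_conj_eq hρ T hT] with x hx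
  change ρ x * T = T * ρ x
  conv_rhs => rw [← hx]
  rw [mul_assoc _ _ (ρ x), ← map_mul, inv_mul_cancel, map_one, mul_one]

theorem isUnimodularOver_of_mem_connectedComponent (hρ : ContMDiff 𝓘(ℂ, E) 𝓘(ℂ, F →L[ℂ] F) ω ρ)
    (htr : ∀ X ∈ operatorAlgebra (E := E) ρ,
      ∀ p ∈ Set.centralizer (operatorAlgebra (E := E) ρ : Set (Module.End ℂ F)),
        LinearMap.trace ℂ F (X * p) = 0) {c : GC} (hc : c ∈ connectedComponent (1 : GC)) :
    IsUnimodularOver (operatorAlgebra (E := E) ρ) (ρ c : Module.End ℂ F) := by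
  have : IsTopologicalGroup GC := topologicalGroup_of_lieGroup 𝓘(ℂ, E) ω
  have hcomm : ∀ T ∈ Set.centralizer (operatorAlgebra (E := E) ρ : Set (Module.End ℂ F)),
      ∀ x ∈ connectedComponent (1 : GC), Commute (ρ x : Module.End ℂ F) T := by
    intro T hT x hx
    have := commute_of_mem_connectedComponent hρ (T := LinearMap.toContinuousLinearMap T) hT hx
    exact congrArg (fun A : F →L[ℂ] F => (A : Module.End ℂ F)) this.eq
  refine ⟨fun T hT => hcomm T hT c hc, fun p hp hpp => ?_⟩
  have hp' : p = (LinearMap.toContinuousLinearMap p : Module.End ℂ F) := rfl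
  set q := LinearMap.toContinuousLinearMap p with hq
  have hqq : IsIdempotentElem q := by
    ext x
    exact LinearMap.congr_fun hpp x
  let K : Subgroup GC :=
    { carrier := {x | Commute (ρ x) q ∧ LinearMap.det ((ρ x * q + 1 - q : F →L[ℂ] F) :
        Module.End ℂ F) = 1}
      mul_mem' := fun {a b} ha hb => by
        refine ⟨by rw [map_mul]; exact ha.1.mul_left hb.1, ?_⟩
        rw [map_mul, ← mul_cut_mul_cut hqq hb.1]
        exact (map_mul LinearMap.det _ _).trans (by rw [ha.2, hb.2, one_mul])
      one_mem' := by
        refine ⟨by rw [map_one]; exact Commute.one_left q, ?_⟩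
        rw [map_one, one_mul, add_sub_cancel_left]
        exact LinearMap.det_id
      inv_mem' := fun {a} ha => by
        have hinv : Commute (ρ a⁻¹) q := by
          have ha' : ρ a * q = q * ρ a := ha.1
          change ρ a⁻¹ * q = q * ρ a⁻¹
          have e1 : ρ a * ρ a⁻¹ = 1 := by rw [← map_mul, mul_inv_cancel, map_one]
          have e2 : ρ a⁻¹ * ρ a = 1 := by rw [← map_mul, inv_mul_cancel, map_one]
          calc ρ a⁻¹ * q = ρ a⁻¹ * (q * ρ a) * ρ a⁻¹ := by
                rw [mul_assoc, mul_assoc q, e1, mul_one]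
            _ = q * ρ a⁻¹ := by rw [← ha', ← mul_assoc, e2, one_mul]
        refine ⟨hinv, ?_⟩
        have h : LinearMap.det ((ρ a * q + 1 - q : F →L[ℂ] F) : Module.End ℂ F) *
            LinearMap.det ((ρ a⁻¹ * q + 1 - q : F →L[ℂ] F) : Module.End ℂ F) = 1 := by
          rw [← map_mul]
          have := mul_cut_mul_cut (A := ρ a) hqq hinv
          rw [← map_mul, mul_inv_cancel, map_one, one_mul, add_sub_cancel_left] at this
          exact (congrArg (fun A : F →L[ℂ] F => LinearMap.det (A : Module.End ℂ F)) this).trans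
            LinearMap.det_id
        rwa [ha.2, one_mul] at h }
  have hK := connectedComponent_subset_of_mem_nhds K ?_ hc
  · have := hK.2
    exact (congrArg norm this).trans norm_one
  · filter_upwards [eventually_conj_eq hρ q hp,
      eventually_det_eq_one hρ q hp (fun X hX => htr X hX p hp) hqq] with x hx hx'
    refine ⟨?_, hx'⟩
    change ρ x * q = q * ρ x
    conv_rhs => rw [← hx]
    rw [mul_assoc _ _ (ρ x), ← map_mul, inv_mul_cancel, map_one, mul_one]

end Component

/-! ### Averaging over a compact group -/

open MeasureTheory in
/-- Averaging over a compact group. -/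
theorem exists_invariant_core {F : Type*} [NormedAddCommGroup F] [NormedSpace ℂ F]
    [FiniteDimensional ℂ F] {K : Type*} [Group K] [TopologicalSpace K] [IsTopologicalGroup K]
    [CompactSpace K] (π : K →* (F →L[ℂ] F)) (hπ : Continuous π) :
    ∃ h : InnerProductSpace.Core ℂ F, ∀ k x y, h.inner (π k x) (π k y) = h.inner x y := by
  let : MeasurableSpace K := borel K
  have : BorelSpace K := ⟨rfl⟩
  let μ : Measure K := Measure.haar
  let e : F ≃L[ℂ] EuclideanSpace ℂ (Fin (Module.finrank ℂ F)) :=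
    ContinuousLinearEquiv.ofFinrankEq (by simp)
  let f : F → F → K → ℂ := fun x y k => inner ℂ (e (π k⁻¹ x)) (e (π k⁻¹ y))
  have hcont : ∀ x y, Continuous (f x y) := by
    intro x y
    have h : ∀ z, Continuous fun k => e (π k⁻¹ z) := fun z =>
      e.continuous.comp ((ContinuousLinearMap.apply ℂ F z).continuous.comp
        (hπ.comp continuous_inv))
    exact (h x).inner (h y)
  have hint : ∀ x y, Integrable (f x y) μ := fun x y =>
    (hcont x y).integrable_of_hasCompactSupport (HasCompactSupport.of_compactSpace _)
  have hself : ∀ x k, f x x k = ((‖e (π k⁻¹ x)‖ ^ 2 : ℝ) : ℂ) := by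
    intro x k
    change inner ℂ _ _ = _
    rw [inner_self_eq_norm_sq_to_K]
    norm_cast
  have hselfint : ∀ x, ∫ k, f x x k ∂μ = ((∫ k, ‖e (π k⁻¹ x)‖ ^ 2 ∂μ : ℝ) : ℂ) := by
    intro x
    simp_rw [hself]
    exact integral_ofReal
  refine ⟨{ inner := fun x y => ∫ k, f x y k ∂μ
            conj_inner_symm := fun x y => ?_
            re_inner_nonneg := fun x => ?_
            add_left := fun x y z => ?_
            smul_left := fun x y r => ?_
            definite := fun x hx => ?_ }, fun a x y => ?_⟩
  · rw [← integral_conj]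
    simp only [f, inner_conj_symm]
  · rw [hselfint]
    exact integral_nonneg fun k => by positivity
  · rw [← integral_add (hint x z) (hint y z)]
    simp only [f, map_add, inner_add_left]
  · rw [← integral_const_mul]
    simp only [f, map_smul, inner_smul_left]
  · change ∫ k, f x x k ∂μ = 0 at hx
    rw [hselfint, Complex.ofReal_eq_zero] at hx
    have hc : Continuous fun k => ‖e (π k⁻¹ x)‖ ^ 2 := by
      have h : Continuous fun k => e (π k⁻¹ x) :=
        e.continuous.comp ((ContinuousLinearMap.apply ℂ F x).continuous.comp
          (hπ.comp continuous_inv))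
      fun_prop
    by_contra hx0
    refine (hc.integral_pos_of_hasCompactSupport_nonneg_nonzero (μ := μ) (x := 1)
      (HasCompactSupport.of_compactSpace _) (fun k => by positivity) ?_).ne' hx
    simpa using hx0
  · change ∫ k, f (π a x) (π a y) k ∂μ = ∫ k, f x y k ∂μ
    -- Translating by `a⁻¹` turns `k⁻¹` into `k⁻¹ a`, which absorbs the action of `a`.
    rw [← integral_mul_left_eq_self (f x y) a⁻¹]
    refine integral_congr_ae (Filter.Eventually.of_forall fun k => ?_)
    have h : ∀ z, π (a⁻¹ * k)⁻¹ z = π k⁻¹ (π a z) := fun z => by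
      rw [mul_inv_rev, inv_inv, map_mul]
      rfl
    simp only [f, h]

/-! ### Transfer to an arbitrary Hermitian inner product -/

section Core

variable {F : Type*} [AddCommGroup F] [Module ℂ F] [FiniteDimensional ℂ F]
  {s : Submodule ℂ (Module.End ℂ F)}

/-- `F` carries no norm in this section, so the norm and inner product of `h` can be installed
locally without conflicting with another norm. -/
theorem core_exists_symmetric_mem (h : InnerProductSpace.Core ℂ F)
    (hadj : ∀ Y ∈ s, ∃ Y' ∈ s, ∀ x y, h.inner (Y' x) y = h.inner x (Y y))
    (hbr : ∀ X ∈ s, ∀ Y ∈ s, X * Y - Y * X ∈ s)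
    (htr : ∀ X ∈ s, ∀ p ∈ Set.centralizer (s : Set (Module.End ℂ F)),
      LinearMap.trace ℂ F (X * p) = 0)
    {A : Module.End ℂ F} (hA : IsUnimodularOver s A) (hinj : Function.Injective A)
    (hleft : ∀ Y ∈ s, ∃ Y' ∈ s, A * Y = Y' * A) (hright : ∀ Y ∈ s, ∃ Y' ∈ s, Y * A = A * Y') :
    ∃ H ∈ s, (∀ x y, h.inner (H x) y = h.inner x (H y)) ∧ ∀ v : F,
      (h.inner v v).re + (h.inner (H v) v).re ≤ (h.inner (A v) (A v)).re := by
  let : NormedAddCommGroup F := h.toNormedAddCommGroup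
  let : InnerProductSpace ℂ F := InnerProductSpace.ofCore h.toCore
  have hstar : ∀ Y ∈ s, star Y ∈ s := by
    intro Y hY
    obtain ⟨Y', hY', e⟩ := hadj Y hY
    have : Y' = star Y := (LinearMap.eq_adjoint_iff Y' Y).2 e
    rwa [← this]
  exact exists_symmetric_mem_inner_le hstar hbr htr hA hinj hleft hright

theorem core_inner_map_map (h : InnerProductSpace.Core ℂ F)
    (hadj : ∀ Y ∈ s, ∃ Y' ∈ s, ∀ x y, h.inner (Y' x) y = h.inner x (Y y))
    (htr : ∀ X ∈ s, ∀ p ∈ Set.centralizer (s : Set (Module.End ℂ F)),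
      LinearMap.trace ℂ F (X * p) = 0)
    {A : Module.End ℂ F} (hA : IsUnimodularOver s A) (hinj : Function.Injective A)
    (hleft : ∀ Y ∈ s, (∀ x y, h.inner (Y x) y = -h.inner x (Y y)) →
      ∃ Y' : Module.End ℂ F, (∀ x y, h.inner (Y' x) y = -h.inner x (Y' y)) ∧ A * Y = Y' * A)
    (x y : F) : h.inner (A x) (A y) = h.inner x y := by
  let : NormedAddCommGroup F := h.toNormedAddCommGroup
  let : InnerProductSpace ℂ F := InnerProductSpace.ofCore h.toCore
  have hstar : ∀ Y ∈ s, star Y ∈ s := by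
    intro Y hY
    obtain ⟨Y', hY', e⟩ := hadj Y hY
    have : Y' = star Y := (LinearMap.eq_adjoint_iff Y' Y).2 e
    rwa [← this]
  have hskew : ∀ Y : Module.End ℂ F, star Y = -Y ↔ ∀ x y, h.inner (Y x) y = -h.inner x (Y y) := by
    intro Y
    rw [eq_comm, neg_eq_iff_eq_neg]
    have e : -star Y = LinearMap.adjoint (-Y) := by
      rw [map_neg]
      rfl
    rw [e, LinearMap.eq_adjoint_iff]
    refine forall₂_congr fun x y => ?_
    change _ = inner ℂ x (-(Y y)) ↔ _
    rw [inner_neg_right]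
  have key := hA.star_mul_self_eq_one hstar htr hinj fun Y hY hYs => by
    obtain ⟨Y', h1, h2⟩ := hleft Y hY ((hskew Y).1 hYs)
    exact ⟨Y', (hskew Y').2 h1, h2⟩
  change inner ℂ (A x) (A y) = inner ℂ x y
  rw [← LinearMap.adjoint_inner_right, ← LinearMap.star_eq_adjoint, ← Module.End.mul_apply, key]
  rfl

end Core

/-! ### Conjugation maps of real forms -/

section Conjugation

variable {F : Type*} [AddCommGroup F] [Module ℂ F] {V V' : Submodule ℝ F}

theorem IsRealForm.exists_eq_add (hV : IsRealForm V) (x : F) :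
    ∃ a ∈ V, ∃ b ∈ V, x = a + Complex.I • b := by
  obtain ⟨a, ha, c, ⟨b, hb, rfl⟩, e⟩ := Submodule.mem_sup.1
    (hV.sup_eq_top ▸ Submodule.mem_top : x ∈ V ⊔ V.map (complexStructure F))
  exact ⟨a, ha, b, hb, e.symm⟩

theorem conjugation_of_mem (hV : IsRealForm V) {x : F} (hx : x ∈ V) : conjugation hV x = x := by
  simpa using conjugation_add_I_smul hV hx V.zero_mem

theorem conjugation_conjugation (hV : IsRealForm V) (x : F) :
    conjugation hV (conjugation hV x) = x := by
  obtain ⟨a, ha, b, hb, rfl⟩ := hV.exists_eq_add x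
  rw [conjugation_add_I_smul hV ha hb, sub_eq_add_neg, ← smul_neg,
    conjugation_add_I_smul hV ha (V.neg_mem hb), smul_neg, sub_neg_eq_add]

theorem mem_of_conjugation_eq (hV : IsRealForm V) {x : F} (hx : conjugation hV x = x) : x ∈ V := by
  obtain ⟨a, ha, b, hb, rfl⟩ := hV.exists_eq_add x
  rw [conjugation_add_I_smul hV ha hb, sub_eq_add_neg, add_right_inj, neg_eq_iff_add_eq_zero,
    ← two_smul ℂ, smul_smul, smul_eq_zero] at hx
  rcases hx with hx | hx
  · simp at hx
  · simpa [hx] using ha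

theorem conjugation_I_smul (hV : IsRealForm V) (x : F) :
    conjugation hV (Complex.I • x) = -(Complex.I • conjugation hV x) := by
  obtain ⟨a, ha, b, hb, rfl⟩ := hV.exists_eq_add x
  have : Complex.I • (a + Complex.I • b) = -b + Complex.I • a := by
    rw [smul_add, smul_smul, Complex.I_mul_I]
    module
  rw [this, conjugation_add_I_smul hV (V.neg_mem hb) ha, conjugation_add_I_smul hV ha hb, smul_sub,
    smul_smul, Complex.I_mul_I]
  module

theorem conjugation_smul (hV : IsRealForm V) (c : ℂ) (x : F) :
    conjugation hV (c • x) = (starRingEnd ℂ c) • conjugation hV x := by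
  have e : ∀ y : F, ∀ z : ℂ, z • y = z.re • y + z.im • (Complex.I • y) := by
    intro y z
    conv_lhs => rw [← Complex.re_add_im z, add_smul, mul_smul]
    simp
  rw [e, map_add, map_smul, map_smul, conjugation_I_smul, e _ (starRingEnd ℂ c), Complex.conj_re,
    Complex.conj_im]
  module

/-- The conjugate `σ T σ` of a complex-linear operator by the conjugation map of a real form. -/
def conjugateOperator (hV : IsRealForm V) (T : Module.End ℂ F) : Module.End ℂ F where
  toFun x := conjugation hV (T (conjugation hV x))
  map_add' x y := by simp only [map_add]
  map_smul' c x := by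
    rw [conjugation_smul, map_smul, conjugation_smul, starRingEnd_self_apply, RingHom.id_apply]

theorem conjugateOperator_apply (hV : IsRealForm V) (T : Module.End ℂ F) (x : F) :
    conjugateOperator hV T x = conjugation hV (T (conjugation hV x)) := rfl

theorem conjugateOperator_mul (hV : IsRealForm V) (S T : Module.End ℂ F) :
    conjugateOperator hV (S * T) = conjugateOperator hV S * conjugateOperator hV T := by
  ext x
  simp [conjugateOperator_apply, conjugation_conjugation]

theorem conjugateOperator_smul (hV : IsRealForm V) (c : ℂ) (T : Module.End ℂ F) :
    conjugateOperator hV (c • T) = starRingEnd ℂ c • conjugateOperator hV T := by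
  ext x
  simp [conjugateOperator_apply, conjugation_smul]

theorem conjugateOperator_one (hV : IsRealForm V) :
    conjugateOperator hV (1 : Module.End ℂ F) = 1 := by
  ext x
  simp [conjugateOperator_apply, conjugation_conjugation]

theorem conjugateOperator_add (hV : IsRealForm V) (S T : Module.End ℂ F) :
    conjugateOperator hV (S + T) = conjugateOperator hV S + conjugateOperator hV T := by
  ext x
  simp [conjugateOperator_apply]

theorem conjugateOperator_sub (hV : IsRealForm V) (S T : Module.End ℂ F) :
    conjugateOperator hV (S - T) = conjugateOperator hV S - conjugateOperator hV T := by
  ext x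
  simp [conjugateOperator_apply]

theorem conjugateOperator_conjugateOperator (hV : IsRealForm V) (T : Module.End ℂ F) :
    conjugateOperator hV (conjugateOperator hV T) = T := by
  ext x
  simp [conjugateOperator_apply, conjugation_conjugation]

/-- Conjugation is real-linear, so it preserves real determinants, and the real determinant of a
complex operator is `|det|²`. This is why unimodularity is phrased with absolute values. -/
theorem norm_det_conjugateOperator [FiniteDimensional ℂ F] (hV : IsRealForm V)
    (T : Module.End ℂ F) :
    ‖LinearMap.det (conjugateOperator hV T)‖ = ‖LinearMap.det T‖ := by
  let σ : F ≃ₗ[ℝ] F := LinearEquiv.ofInvolutive (conjugation hV) (conjugation_conjugation hV)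
  have h1 : (conjugateOperator hV T).restrictScalars ℝ =
      (σ : F →ₗ[ℝ] F) ∘ₗ T.restrictScalars ℝ ∘ₗ (σ.symm : F →ₗ[ℝ] F) := rfl
  have h2 : LinearMap.det ((conjugateOperator hV T).restrictScalars ℝ) =
      LinearMap.det (T.restrictScalars ℝ) := by
    rw [h1, LinearMap.det_conj]
  rw [LinearMap.det_restrictScalars, LinearMap.det_restrictScalars, Algebra.norm_complex_apply,
    Algebra.norm_complex_apply, Complex.normSq_eq_norm_sq, Complex.normSq_eq_norm_sq] at h2
  exact (sq_eq_sq₀ (norm_nonneg _) (norm_nonneg _)).1 h2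

theorem IsUnimodularOver.conjugateOperator [FiniteDimensional ℂ F] (hV : IsRealForm V)
    {s : Submodule ℂ (Module.End ℂ F)} (hs : ∀ Y ∈ s, conjugateOperator hV Y ∈ s)
    {A : Module.End ℂ F} (hA : IsUnimodularOver s A) :
    IsUnimodularOver s (conjugateOperator hV A) := by
  have key : ∀ T ∈ Set.centralizer (s : Set (Module.End ℂ F)),
      CompatibleForms.conjugateOperator hV T ∈ Set.centralizer (s : Set (Module.End ℂ F)) := by
    intro T hT Y hY
    have := congrArg (CompatibleForms.conjugateOperator hV) (hT _ (hs Y hY))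
    rwa [conjugateOperator_mul, conjugateOperator_mul, conjugateOperator_conjugateOperator] at this
  refine ⟨fun T hT => ?_, fun p hp hpp => ?_⟩
  · have := congrArg (CompatibleForms.conjugateOperator hV) (hA.commute _ (key T hT)).eq
    rwa [conjugateOperator_mul, conjugateOperator_mul, conjugateOperator_conjugateOperator] at this
  · have hpp' : IsIdempotentElem (CompatibleForms.conjugateOperator hV p) := by
      change _ * _ = _
      rw [← conjugateOperator_mul, hpp.eq]
    have h := hA.norm_det _ (key p hp) hpp'
    rwa [← norm_det_conjugateOperator hV, conjugateOperator_sub, conjugateOperator_add,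
      conjugateOperator_mul, conjugateOperator_one, conjugateOperator_conjugateOperator] at h

/-- The sum of a Hermitian inner product and its conjugate. -/
@[reducible] def addConjugate (hV : IsRealForm V) (h : InnerProductSpace.Core ℂ F) :
    InnerProductSpace.Core ℂ F where
  inner x y := h.inner x y + starRingEnd ℂ (h.inner (conjugation hV x) (conjugation hV y))
  conj_inner_symm x y := by
    rw [map_add, h.conj_inner_symm, h.conj_inner_symm]
  re_inner_nonneg x := by
    rw [map_add]
    exact add_nonneg (h.re_inner_nonneg x) (by simpa using h.re_inner_nonneg (conjugation hV x))
  add_left x y z := by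
    rw [map_add, h.add_left, h.add_left, map_add]
    ring
  smul_left x y r := by
    rw [conjugation_smul, h.smul_left, h.smul_left, map_mul, starRingEnd_self_apply]
    ring
  definite x hx := by
    have h1 := congrArg Complex.re hx
    have h2 := h.re_inner_nonneg x
    have h3 := h.re_inner_nonneg (conjugation hV x)
    simp only [RCLike.re_to_complex, Complex.add_re, Complex.conj_re, Complex.zero_re] at h1 h2 h3
    have h4 := congrArg Complex.im (h.conj_inner_symm x x)
    rw [Complex.conj_im] at h4
    exact h.definite x (Complex.ext (by simp; linarith) (by simp; linarith))

theorem isRealOn_of_inner_conjugation (hV : IsRealForm V) {h : InnerProductSpace.Core ℂ F}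
    (hh : ∀ x y, h.inner (conjugation hV x) (conjugation hV y) = starRingEnd ℂ (h.inner x y)) :
    IsRealOn h V := by
  intro x hx y hy
  have := hh x y
  rw [conjugation_of_mem hV hx, conjugation_of_mem hV hy] at this
  exact Complex.conj_eq_iff_im.1 this.symm

theorem addConjugate_inner_conjugation (hV : IsRealForm V) (h : InnerProductSpace.Core ℂ F)
    (x y : F) : (addConjugate hV h).inner (conjugation hV x) (conjugation hV y) =
      starRingEnd ℂ ((addConjugate hV h).inner x y) := by
  change h.inner _ _ + starRingEnd ℂ (h.inner _ _) = starRingEnd ℂ (h.inner _ _ + starRingEnd ℂ _)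
  rw [conjugation_conjugation, conjugation_conjugation, map_add, starRingEnd_self_apply, add_comm]

theorem addConjugate_inner_conjugation_of_commute (hV : IsRealForm V) (hV' : IsRealForm V')
    (hc : Commute (conjugation hV) (conjugation hV')) (h : InnerProductSpace.Core ℂ F)
    (hh : ∀ x y, h.inner (conjugation hV x) (conjugation hV y) = starRingEnd ℂ (h.inner x y))
    (x y : F) : (addConjugate hV' h).inner (conjugation hV x) (conjugation hV y) =
      starRingEnd ℂ ((addConjugate hV' h).inner x y) := by
  have hc' : ∀ z, conjugation hV' (conjugation hV z) = conjugation hV (conjugation hV' z) :=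
    fun z => (LinearMap.congr_fun hc.eq z).symm
  change h.inner _ _ + starRingEnd ℂ (h.inner _ _) = starRingEnd ℂ (h.inner _ _ + starRingEnd ℂ _)
  rw [hc', hc', hh, hh, map_add]

end Conjugation

/-! ### The two key estimates for an abstract infinitesimal action -/

section Abstract

variable {F : Type*} [AddCommGroup F] [Module ℂ F] {L : Type*} [AddCommGroup L] [Module ℂ L]
  {D : L →ₗ[ℂ] Module.End ℂ F} {g u : Submodule ℝ L} {V : Submodule ℝ F}

theorem core_inner_smul_right (h : InnerProductSpace.Core ℂ F) (x y : F) (c : ℂ) :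
    h.inner x (c • y) = c * h.inner x y := by
  rw [← h.conj_inner_symm, h.smul_left, map_mul, starRingEnd_self_apply, h.conj_inner_symm]

theorem core_inner_add_right (h : InnerProductSpace.Core ℂ F) (x y z : F) :
    h.inner x (y + z) = h.inner x y + h.inner x z := by
  rw [← h.conj_inner_symm, h.add_left, map_add, h.conj_inner_symm, h.conj_inner_symm]

/-- For skew `a` and `b`, the adjoint of `a + i b` is `-a + i b`. -/
theorem exists_adjoint_mem_range (h : InnerProductSpace.Core ℂ F) (hu : IsRealForm u)
    (hskew : ∀ X ∈ u, ∀ x y, h.inner (D X x) y = -h.inner x (D X y)) :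
    ∀ Y ∈ LinearMap.range D, ∃ Y' ∈ LinearMap.range D, ∀ x y, h.inner (Y' x) y = h.inner x (Y y) := by
  rintro _ ⟨X, rfl⟩
  obtain ⟨a, ha, b, hb, rfl⟩ := hu.exists_eq_add X
  refine ⟨D (((-1 : ℂ)) • a + Complex.I • b), ⟨_, rfl⟩, fun x y => ?_⟩
  simp only [map_add, map_smul, LinearMap.add_apply, LinearMap.smul_apply, h.add_left, h.smul_left,
    core_inner_add_right, core_inner_smul_right, hskew a ha, hskew b hb]
  simp

/-- If `D (a + i b)` is skew with `a, b ∈ u`, then `i D b` is both skew and Hermitian, so `D b = 0`.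
-/
theorem exists_mem_eq_of_skew (h : InnerProductSpace.Core ℂ F) (hu : IsRealForm u)
    (hskew : ∀ X ∈ u, ∀ x y, h.inner (D X x) y = -h.inner x (D X y)) {Y : Module.End ℂ F}
    (hY : Y ∈ LinearMap.range D) (hYs : ∀ x y, h.inner (Y x) y = -h.inner x (Y y)) :
    ∃ X ∈ u, Y = D X := by
  obtain ⟨X, rfl⟩ := hY
  obtain ⟨a, ha, b, hb, rfl⟩ := hu.exists_eq_add X
  refine ⟨a, ha, ?_⟩
  have hzero : ∀ x, D b x = 0 := by
    intro x
    refine h.definite _ ?_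
    have h1 := hYs x (D b x)
    simp only [map_add, map_smul, LinearMap.add_apply, LinearMap.smul_apply, h.add_left,
      h.smul_left, core_inner_add_right, core_inner_smul_right, hskew a ha, hskew b hb,
      Complex.conj_I] at h1
    rw [hskew b hb]
    have h2 : Complex.I * h.inner x (D b (D b x)) = 0 := by linear_combination h1 / 2
    rw [(mul_eq_zero.1 h2).resolve_left Complex.I_ne_zero, neg_zero]
  rw [map_add, map_smul]
  have : D b = 0 := LinearMap.ext hzero
  rw [this, smul_zero, add_zero]

theorem conjugation_mem_of_commute {W W' : Submodule ℝ L} (hW : IsRealForm W)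
    (hW' : IsRealForm W') (hc : Commute (conjugation hW) (conjugation hW')) {x : L} (hx : x ∈ W') :
    conjugation hW x ∈ W' := by
  refine mem_of_conjugation_eq hW' ?_
  have := LinearMap.congr_fun hc.eq x
  rw [Module.End.mul_apply, Module.End.mul_apply, conjugation_of_mem hW' hx] at this
  exact this.symm

/-- Both sides are conjugate-linear in `X` and agree on the real form `g`. -/
theorem conjugateOperator_eq_conjugation (hg : IsRealForm g) (hV : IsRealForm V)
    (hgV : ∀ X ∈ g, conjugateOperator hV (D X) = D X) (X : L) :
    conjugateOperator hV (D X) = D (conjugation hg X) := by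
  obtain ⟨a, ha, b, hb, rfl⟩ := hg.exists_eq_add X
  rw [conjugation_add_I_smul hg ha hb, map_add, map_smul, map_sub, map_smul,
    conjugateOperator_add, conjugateOperator_smul, hgV a ha, hgV b hb, Complex.conj_I, neg_smul,
    sub_eq_add_neg]

variable [FiniteDimensional ℂ F]

/-- The operator `σ R σ R⁻¹` is shown to be unitary. Conjugation by it preserves the image of `u`:
`R` does so because it is unitary and normalizes the range, and `σ` does so because the conjugations
of `g` and `u` commute. -/
theorem inner_conjugateOperator (h : InnerProductSpace.Core ℂ F) (hu : IsRealForm u)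
    (hg : IsRealForm g) (hV : IsRealForm V)
    (hskew : ∀ X ∈ u, ∀ x y, h.inner (D X x) y = -h.inner x (D X y))
    (htr : ∀ X ∈ LinearMap.range D,
      ∀ p ∈ Set.centralizer (LinearMap.range D : Set (Module.End ℂ F)),
        LinearMap.trace ℂ F (X * p) = 0)
    (hgV : ∀ X ∈ g, conjugateOperator hV (D X) = D X)
    (hc : Commute (conjugation hg) (conjugation hu)) {R R' : Module.End ℂ F} (hRR' : R * R' = 1)
    (hR'R : R' * R = 1) (hR : ∀ x y, h.inner (R x) (R y) = h.inner x y)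
    (hnorm : ∀ Y ∈ LinearMap.range D, R * Y * R' ∈ LinearMap.range D)
    (hnorm' : ∀ Y ∈ LinearMap.range D, R' * Y * R ∈ LinearMap.range D)
    (hB : IsUnimodularOver (LinearMap.range D) (conjugateOperator hV R * R')) (x y : F) :
    h.inner (conjugateOperator hV R x) (conjugateOperator hV R y) = h.inner x y := by
  have hconj := conjugateOperator_eq_conjugation hg hV hgV
  have happ : ∀ z, R (R' z) = z := fun z => LinearMap.congr_fun hRR' z
  have happ' : ∀ z, R' (R z) = z := fun z => LinearMap.congr_fun hR'R z
  have hRskew : ∀ Y ∈ LinearMap.range D, (∀ x y, h.inner (Y x) y = -h.inner x (Y y)) →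
      ∃ X ∈ u, R * Y * R' = D X := by
    intro Y hY hYs
    refine exists_mem_eq_of_skew h hu hskew (hnorm Y hY) fun x y => ?_
    have := hYs (R' x) (R' y)
    rw [← hR, ← hR (R' x), happ, happ] at this
    exact this
  have hR'skew : ∀ Y ∈ LinearMap.range D, (∀ x y, h.inner (Y x) y = -h.inner x (Y y)) →
      ∃ X ∈ u, R' * Y * R = D X := by
    intro Y hY hYs
    refine exists_mem_eq_of_skew h hu hskew (hnorm' Y hY) fun x y => ?_
    have := hYs (R x) (R y)
    rw [← hR, ← hR x]
    change h.inner (R (R' (Y (R x)))) (R y) = -h.inner (R x) (R (R' (Y (R y))))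
    rw [happ, happ, this]
  have key := core_inner_map_map h (exists_adjoint_mem_range h hu hskew) htr hB ?_ ?_ (R x) (R y)
  · simp only [Module.End.mul_apply, happ', hR] at key
    exact key
  · refine Function.LeftInverse.injective (g := R * conjugateOperator hV R') fun z => ?_
    have h1 : conjugateOperator hV R' * conjugateOperator hV R = 1 := by
      rw [← conjugateOperator_mul, hR'R, conjugateOperator_one]
    have : R * conjugateOperator hV R' * (conjugateOperator hV R * R') = 1 := by
      rw [mul_assoc, ← mul_assoc _ _ R', h1, one_mul, hRR']
    exact LinearMap.congr_fun this z
  · intro Y hY hYs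
    -- `Y` is carried successively by `R'`, `σ`, `R` and `σ`, staying in the image of `u` each time.
    obtain ⟨X₁, hX₁, e₁⟩ := hR'skew Y hY hYs
    have hX₁' := conjugation_mem_of_commute hg hu hc hX₁
    obtain ⟨X₂, hX₂, e₂⟩ := hRskew (D (conjugation hg X₁)) ⟨_, rfl⟩ (hskew _ hX₁')
    have hX₂' := conjugation_mem_of_commute hg hu hc hX₂
    refine ⟨D (conjugation hg X₂), hskew _ hX₂', ?_⟩
    have e₃ : R * D (conjugation hg X₁) = D X₂ * R := by
      rw [← e₂, mul_assoc, hR'R, mul_one]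
    have e₄ : R' * Y = D X₁ * R' := by
      rw [← e₁, mul_assoc, hRR', mul_one]
    rw [← hconj, ← mul_assoc, ← conjugateOperator_mul, ← e₃, conjugateOperator_mul, hconj,
      conjugation_conjugation, mul_assoc, e₄, mul_assoc]

theorem inner_le_of_critical (h : InnerProductSpace.Core ℂ F) (hu : IsRealForm u)
    (hg : IsRealForm g)
    (hskew : ∀ X ∈ u, ∀ x y, h.inner (D X x) y = -h.inner x (D X y))
    (hbr : ∀ X ∈ LinearMap.range D, ∀ Y ∈ LinearMap.range D, X * Y - Y * X ∈ LinearMap.range D)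
    (htr : ∀ X ∈ LinearMap.range D,
      ∀ p ∈ Set.centralizer (LinearMap.range D : Set (Module.End ℂ F)),
        LinearMap.trace ℂ F (X * p) = 0)
    (hc : Commute (conjugation hg) (conjugation hu)) {A A' : Module.End ℂ F} (hAA' : A * A' = 1)
    (hA'A : A' * A = 1) (hA : IsUnimodularOver (LinearMap.range D) A)
    (hnorm : ∀ Y ∈ LinearMap.range D, A * Y * A' ∈ LinearMap.range D)
    (hnorm' : ∀ Y ∈ LinearMap.range D, A' * Y * A ∈ LinearMap.range D)
    (hreal : IsRealOn h V) {v : F} (hv : v ∈ V) (hgV : ∀ X ∈ g, D X v ∈ V)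
    (hcrit : ∀ X ∈ g, (h.inner (D X v) v).re = 0) :
    (h.inner v v).re ≤ (h.inner (A v) (A v)).re := by
  obtain ⟨_, ⟨X, rfl⟩, -, hle⟩ := core_exists_symmetric_mem h
    (exists_adjoint_mem_range h hu hskew) hbr htr hA
    (Function.LeftInverse.injective (g := A') fun z => LinearMap.congr_fun hA'A z)
    (fun Y hY => ⟨_, hnorm Y hY, by rw [mul_assoc, hA'A, mul_one]⟩)
    (fun Y hY => ⟨_, hnorm' Y hY, by rw [← mul_assoc, ← mul_assoc, hAA', one_mul]⟩)
  have hre : ∀ X ∈ u, (h.inner (D X v) v).re = 0 := by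
    intro X hX
    have h1 := congrArg Complex.re (hskew X hX v v)
    rw [← h.conj_inner_symm v, Complex.neg_re, Complex.conj_re] at h1
    linarith
  suffices h0 : (h.inner (D X v) v).re = 0 by
    have := hle v
    rwa [h0, add_zero] at this
  obtain ⟨a, ha, b, hb, rfl⟩ := hu.exists_eq_add X
  have hb' := conjugation_mem_of_commute hg hu hc hb
  set c := (2⁻¹ : ℝ) • (b + conjugation hg b) with hcdef
  set d := (2⁻¹ : ℝ) • (b - conjugation hg b) with hddef
  have hcd : b = c + d := by
    rw [hcdef, hddef]
    module
  have hcu : c ∈ u := u.smul_mem _ (u.add_mem hb hb')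
  have hcg : c ∈ g := mem_of_conjugation_eq hg (by
    rw [hcdef, map_smul, map_add, conjugation_conjugation, add_comm])
  have hdg : Complex.I • d ∈ g := mem_of_conjugation_eq hg (by
    rw [conjugation_I_smul, ← smul_neg, hddef, map_smul, map_sub, conjugation_conjugation,
      ← smul_neg, neg_sub])
  -- Here `c ∈ u ∩ g` and `i d ∈ g`. The `a` term is killed by skewness, the `i d` term by
  -- criticality; `⟨D c v, v⟩` is real on `V` and imaginary by skewness, hence zero.
  have e : D (a + Complex.I • b) v = D a v + (Complex.I • D c v + D (Complex.I • d) v) := by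
    rw [hcd]
    simp only [map_add, map_smul, LinearMap.add_apply, LinearMap.smul_apply, smul_add]
  rw [e, h.add_left, h.add_left, h.smul_left, Complex.add_re, Complex.add_re, hre a ha,
    hcrit _ hdg, Complex.conj_I, Complex.mul_re, hreal _ (hgV c hcg) _ hv, hre c hcu]
  simp

end Abstract

/-! ### Consequences of a definite Killing form on the compact real form -/

section Killing

/-- A linear functional which vanishes on brackets is zero if the Killing form is nondegenerate. -/
theorem eq_zero_of_killingForm {L : Type*} [LieRing L] [LieAlgebra ℂ L] [FiniteDimensional ℂ L]
    (hκ : ∀ x : L, (∀ y, killingForm ℂ L x y = 0) → x = 0) (φ : L →ₗ[ℂ] ℂ)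
    (hφ : ∀ a b : L, φ ⁅a, b⁆ = 0) : φ = 0 := by
  have hinj : Function.Injective (killingForm ℂ L : L →ₗ[ℂ] L →ₗ[ℂ] ℂ) := by
    rw [← LinearMap.ker_eq_bot, LinearMap.ker_eq_bot']
    exact fun x hx => hκ x fun y => LinearMap.congr_fun hx y
  -- By nondegeneracy `φ` is `κ(y, ·)`; invariance makes `y` central, so `ad y = 0` and `φ = 0`.
  obtain ⟨y, rfl⟩ := (LinearMap.injective_iff_surjective_of_finrank_eq_finrank
    (Subspace.dual_finrank_eq (K := ℂ) (V := L)).symm).1 hinj φ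
  have hy : ∀ a : L, ⁅y, a⁆ = 0 := fun a => hκ _ fun b => by
    have := LieModule.traceForm_apply_lie_apply ℂ L L y a b
    exact this.trans (hφ a b)
  have had : LieAlgebra.ad ℂ L y = 0 := by
    ext a
    exact hy a
  ext z
  rw [killingForm_apply_apply, had, LinearMap.zero_comp, map_zero, LinearMap.zero_apply]

/-- For `a + i b` in the radical with `a, b ∈ u`, pairing with `a` and `b` and using that the form
is real on `u` isolates `B(a, a)` and `B(b, b)`. -/
theorem killingForm_nondegenerate {L : Type*} [LieRing L] [LieAlgebra ℂ L] {u : Submodule ℝ L}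
    (hu : IsRealForm u) (hslice : IsRealSlice (-killingForm ℂ L) u)
    (hpos : ∀ x ∈ u, x ≠ 0 → 0 < ((-killingForm ℂ L) x x).re) (x : L)
    (hx : ∀ y, killingForm ℂ L x y = 0) : x = 0 := by
  obtain ⟨a, ha, b, hb, rfl⟩ := hu.exists_eq_add x
  set B := -killingForm ℂ L with hB
  have hx' : ∀ y, B a y + Complex.I * B b y = 0 := by
    intro y
    have := hx y
    rw [map_add, map_smul, LinearMap.add_apply, LinearMap.smul_apply, smul_eq_mul] at this
    rw [hB, LinearMap.neg_apply, LinearMap.neg_apply, LinearMap.neg_apply, LinearMap.neg_apply]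
    linear_combination -this
  have ha0 : a = 0 := by
    by_contra h0
    have h1 := congrArg Complex.re (hx' a)
    have h2 := hslice.1 b hb a ha
    simp [h2] at h1
    exact (hpos a ha h0).ne' h1
  have hb0 : b = 0 := by
    by_contra h0
    have h1 := congrArg Complex.im (hx' b)
    have h2 := hslice.1 a ha b hb
    simp [h2] at h1
    exact (hpos b hb h0).ne' h1
  simp [ha0, hb0]

end Killing

/-! ### One-parameter subgroups under a representation -/

section Tangent

variable {E : Type*} [NormedAddCommGroup E] [NormedSpace ℂ E]
  {GC : Type*} [TopologicalSpace GC] [ChartedSpace E GC] [Group GC]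
  [LieGroup 𝓘(ℂ, E) ω GC]
  {F : Type*} [NormedAddCommGroup F] [NormedSpace ℂ F]
  {ρ : GC →* (F →L[ℂ] F)}

theorem IsTangentToSubgroup.exists_curve (hρ : ContMDiff 𝓘(ℂ, E) 𝓘(ℂ, F →L[ℂ] F) ω ρ)
    {H : Subgroup GC} {X : GroupLieAlgebra 𝓘(ℂ, E) GC} (hX : IsTangentToSubgroup H X) :
    ∃ γ : ℝ → GC, γ 0 = 1 ∧ (∀ t, γ t ∈ H) ∧
      ∀ x : F, HasDerivAt (fun t => ρ (γ t) x) (operatorRep ρ X x) 0 := by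
  obtain ⟨γ, hadd, hmem, -, hd⟩ := hX
  have h0 : γ 0 = 1 := by
    have := hadd 0 0
    rw [add_zero] at this
    exact left_eq_mul.1 this
  refine ⟨γ, h0, hmem, fun x => ?_⟩
  have h1 : HasDerivAt (fun t => ρ (γ t)) (derivativeAtOne (E := E) ρ X) 0 :=
    hasDerivAt_comp_oneParameter hρ h0 hd
  exact (((ContinuousLinearMap.apply ℂ F x).restrictScalars ℝ).hasFDerivAt).comp_hasDerivAt 0 h1

variable [FiniteDimensional ℂ F]

theorem IsTangentToSubgroup.conjugateOperator_eq (hρ : ContMDiff 𝓘(ℂ, E) 𝓘(ℂ, F →L[ℂ] F) ω ρ)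
    {H : Subgroup GC} {X : GroupLieAlgebra 𝓘(ℂ, E) GC} (hX : IsTangentToSubgroup H X)
    {V : Submodule ℝ F} (hV : IsRealForm V)
    (hHV : ∀ a ∈ H, conjugateOperator hV (ρ a : Module.End ℂ F) = ρ a) :
    conjugateOperator hV (operatorRep ρ X) = operatorRep ρ X := by
  obtain ⟨γ, h0, hmem, hd⟩ := hX.exists_curve hρ
  ext x
  let σ : F →L[ℝ] F := LinearMap.toContinuousLinearMap (conjugation hV)
  have h1 := σ.hasFDerivAt.comp_hasDerivAt (0 : ℝ) (hd (conjugation hV x))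
  have h2 : (σ ∘ fun t => ρ (γ t) (conjugation hV x)) = fun t => ρ (γ t) x := by
    ext t
    exact LinearMap.congr_fun (hHV _ (hmem t)) x
  rw [h2] at h1
  exact h1.unique (hd x)

theorem IsTangentToSubgroup.hasDerivAt_inner (hρ : ContMDiff 𝓘(ℂ, E) 𝓘(ℂ, F →L[ℂ] F) ω ρ)
    {H : Subgroup GC} {X : GroupLieAlgebra 𝓘(ℂ, E) GC} (hX : IsTangentToSubgroup H X)
    (h : InnerProductSpace.Core ℂ F) :
    ∃ γ : ℝ → GC, γ 0 = 1 ∧ (∀ t, γ t ∈ H) ∧ ∀ x y : F,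
      HasDerivAt (fun t => h.inner (ρ (γ t) x) (ρ (γ t) y))
        (h.inner (operatorRep ρ X x) y + h.inner x (operatorRep ρ X y)) 0 := by
  obtain ⟨γ, h0, hmem, hd⟩ := hX.exists_curve hρ
  refine ⟨γ, h0, hmem, fun x y => ?_⟩
  have hsm : ∀ (r : ℝ) (z : F), r • z = (r : ℂ) • z := fun r z => (Complex.coe_smul r z).symm
  -- `h` is unrelated to the norm of `F`; its continuity as a real bilinear map comes from finite
  -- dimension.
  let B : F →ₗ[ℝ] F →ₗ[ℝ] ℂ := LinearMap.mk₂ ℝ h.inner h.add_left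
    (fun r x y => by rw [hsm, h.smul_left, Complex.conj_ofReal, Complex.real_smul])
    (core_inner_add_right h)
    (fun r x y => by rw [hsm, core_inner_smul_right, Complex.real_smul])
  let B' : F →L[ℝ] F →L[ℝ] ℂ := LinearMap.toContinuousLinearMap
    ((LinearMap.toContinuousLinearMap : (F →ₗ[ℝ] ℂ) ≃ₗ[ℝ] (F →L[ℝ] ℂ)).toLinearMap ∘ₗ B)
  have h1 := (B'.hasFDerivAt.comp_hasDerivAt (0 : ℝ) (hd x)).clm_apply (hd y)
  refine h1.congr_deriv ?_
  simp only [h0, map_one, Function.comp]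
  rfl

theorem IsTangentToSubgroup.skew (hρ : ContMDiff 𝓘(ℂ, E) 𝓘(ℂ, F →L[ℂ] F) ω ρ)
    {H : Subgroup GC} {X : GroupLieAlgebra 𝓘(ℂ, E) GC} (hX : IsTangentToSubgroup H X)
    {h : InnerProductSpace.Core ℂ F} (hH : IsInvariantUnder h ρ H) (x y : F) :
    h.inner (operatorRep ρ X x) y = -h.inner x (operatorRep ρ X y) := by
  obtain ⟨γ, -, hmem, hd⟩ := hX.hasDerivAt_inner hρ h
  have h1 := hd x y
  simp_rw [hH _ (hmem _)] at h1
  exact eq_neg_of_add_eq_zero_left (h1.unique (hasDerivAt_const _ _))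

theorem IsTangentToSubgroup.re_inner_eq_zero (hρ : ContMDiff 𝓘(ℂ, E) 𝓘(ℂ, F →L[ℂ] F) ω ρ)
    {H : Subgroup GC} {X : GroupLieAlgebra 𝓘(ℂ, E) GC} (hX : IsTangentToSubgroup H X)
    {h : InnerProductSpace.Core ℂ F} {W : Submodule ℝ F} {v : F}
    (hv : v ∈ minimalVectors h ρ H W) : (h.inner (operatorRep ρ X v) v).re = 0 := by
  obtain ⟨γ, h0, hmem, hd⟩ := hX.hasDerivAt_inner hρ h
  have h1 := Complex.reCLM.hasFDerivAt.comp_hasDerivAt (0 : ℝ) (hd v v)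
  have hmin : IsLocalMin (Complex.reCLM ∘ fun t => h.inner (ρ (γ t) v) (ρ (γ t) v)) 0 := by
    refine Filter.Eventually.of_forall fun t => ?_
    simp only [Function.comp, h0, map_one]
    exact hv.2 _ (hmem t)
  have h2 := hmin.hasDerivAt_eq_zero h1
  rw [map_add, Complex.reCLM_apply, Complex.reCLM_apply, ← h.conj_inner_symm v,
    Complex.conj_re] at h2
  linarith

theorem conjugateOperator_eq_of_preserves {GC : Type*} [Group GC] {F : Type*}
    [NormedAddCommGroup F] [NormedSpace ℂ F] {ρ : GC →* (F →L[ℂ] F)} {V : Submodule ℝ F}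
    (hV : IsRealForm V) {a : GC} (ha : ∀ v ∈ V, ρ a v ∈ V) : conjugateOperator hV (ρ a : Module.End ℂ F) = ρ a := by
  ext x
  obtain ⟨y, hy, z, hz, rfl⟩ := hV.exists_eq_add x
  rw [conjugateOperator_apply, conjugation_add_I_smul hV hy hz]
  simp only [ContinuousLinearMap.coe_coe, map_sub, map_add, map_smul]
  rw [conjugation_I_smul, conjugation_of_mem hV (ha y hy), conjugation_of_mem hV (ha z hz),
    sub_neg_eq_add]

end Tangent

/-! ### Application to representations of the group -/

section Representation

theorem map_mul_map_inv {GC : Type*} [Group GC] {F : Type*} [NormedAddCommGroup F]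
    [NormedSpace ℂ F] {ρ : GC →* (F →L[ℂ] F)} (a : GC) :
    (ρ a : Module.End ℂ F) * (ρ a⁻¹ : Module.End ℂ F) = 1 := by
  have : ρ a * ρ a⁻¹ = 1 := by rw [← map_mul, mul_inv_cancel, map_one]
  exact congrArg (fun A : F →L[ℂ] F => (A : Module.End ℂ F)) this

theorem map_inv_mul_map {GC : Type*} [Group GC] {F : Type*} [NormedAddCommGroup F]
    [NormedSpace ℂ F] {ρ : GC →* (F →L[ℂ] F)} (a : GC) :
    (ρ a⁻¹ : Module.End ℂ F) * (ρ a : Module.End ℂ F) = 1 := by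
  have : ρ a⁻¹ * ρ a = 1 := by rw [← map_mul, inv_mul_cancel, map_one]
  exact congrArg (fun A : F →L[ℂ] F => (A : Module.End ℂ F)) this

variable {E : Type*} [NormedAddCommGroup E] [NormedSpace ℂ E]
  {GC : Type*} [TopologicalSpace GC] [ChartedSpace E GC] [Group GC]
  [LieGroup 𝓘(ℂ, E) ω GC]
  {F : Type*} [NormedAddCommGroup F] [NormedSpace ℂ F]
  {ρ : GC →* (F →L[ℂ] F)}

theorem conj_mem_operatorAlgebra (hρ : ContMDiff 𝓘(ℂ, E) 𝓘(ℂ, F →L[ℂ] F) ω ρ) (a : GC) :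
    ∀ Y ∈ operatorAlgebra (E := E) ρ,
      (ρ a : Module.End ℂ F) * Y * (ρ a⁻¹ : Module.End ℂ F) ∈ operatorAlgebra (E := E) ρ := by
  rintro _ ⟨X, rfl⟩
  obtain ⟨Y, hY⟩ := conj_derivativeAtOne hρ a X
  exact ⟨Y, congrArg (fun A : F →L[ℂ] F => (A : Module.End ℂ F)) hY.symm⟩

theorem conj_mem_operatorAlgebra' (hρ : ContMDiff 𝓘(ℂ, E) 𝓘(ℂ, F →L[ℂ] F) ω ρ) (a : GC) :
    ∀ Y ∈ operatorAlgebra (E := E) ρ,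
      (ρ a⁻¹ : Module.End ℂ F) * Y * (ρ a : Module.End ℂ F) ∈ operatorAlgebra (E := E) ρ := by
  intro Y hY
  have := conj_mem_operatorAlgebra hρ a⁻¹ Y hY
  rwa [inv_inv] at this

variable [FiniteDimensional ℂ E]

theorem operatorRep_lie (hρ : ContMDiff 𝓘(ℂ, E) 𝓘(ℂ, F →L[ℂ] F) ω ρ)
    (X Y : GroupLieAlgebra 𝓘(ℂ, E) GC) :
    operatorRep ρ ⁅X, Y⁆ = operatorRep ρ X * operatorRep ρ Y - operatorRep ρ Y * operatorRep ρ X :=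
  congrArg (fun A : F →L[ℂ] F => (A : Module.End ℂ F)) (derivativeAtOne_lie hρ X Y)

theorem commutator_mem_operatorAlgebra (hρ : ContMDiff 𝓘(ℂ, E) 𝓘(ℂ, F →L[ℂ] F) ω ρ) :
    ∀ X ∈ operatorAlgebra (E := E) ρ, ∀ Y ∈ operatorAlgebra (E := E) ρ,
      X * Y - Y * X ∈ operatorAlgebra (E := E) ρ := by
  rintro _ ⟨X, rfl⟩ _ ⟨Y, rfl⟩
  exact ⟨⁅X, Y⁆, operatorRep_lie hρ X Y⟩

/-- For `p` in the commutant, `X ↦ tr (X p)` vanishes on brackets by cyclicity of the trace. -/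
theorem trace_mul_eq_zero (hρ : ContMDiff 𝓘(ℂ, E) 𝓘(ℂ, F →L[ℂ] F) ω ρ)
    (hκ : ∀ x : GroupLieAlgebra 𝓘(ℂ, E) GC,
      (∀ y, killingForm ℂ (GroupLieAlgebra 𝓘(ℂ, E) GC) x y = 0) → x = 0) :
    ∀ X ∈ operatorAlgebra (E := E) ρ,
      ∀ p ∈ Set.centralizer (operatorAlgebra (E := E) ρ : Set (Module.End ℂ F)),
        LinearMap.trace ℂ F (X * p) = 0 := by
  rintro _ ⟨X, rfl⟩ p hp
  have : FiniteDimensional ℂ (GroupLieAlgebra 𝓘(ℂ, E) GC) := inferInstanceAs (FiniteDimensional ℂ E)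
  have h0 := eq_zero_of_killingForm hκ
    (LinearMap.trace ℂ F ∘ₗ LinearMap.mulRight ℂ p ∘ₗ operatorRep ρ) fun a b => by
      have hb : operatorRep ρ b * p = p * operatorRep ρ b := hp _ ⟨b, rfl⟩
      change LinearMap.trace ℂ F (operatorRep ρ ⁅a, b⁆ * p) = 0
      rw [operatorRep_lie hρ, sub_mul, map_sub, mul_assoc, hb, ← mul_assoc,
        LinearMap.trace_mul_comm, ← mul_assoc, sub_self]
  exact LinearMap.congr_fun h0 X

variable [FiniteDimensional ℂ F]

variable {G U : Subgroup GC} {g u : Submodule ℝ (GroupLieAlgebra 𝓘(ℂ, E) GC)}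
  {V : Submodule ℝ F}

/-- The conjugate of a `U`-invariant inner product is `U`-invariant. -/
theorem IsInvariantUnder.addConjugate (hG : IsGroupRealForm G g) (hU : IsGroupRealForm U u)
    (hκ : ∀ x : GroupLieAlgebra 𝓘(ℂ, E) GC,
      (∀ y, killingForm ℂ (GroupLieAlgebra 𝓘(ℂ, E) GC) x y = 0) → x = 0)
    (hgu : AreCompatible g u) (hρ : ContMDiff 𝓘(ℂ, E) 𝓘(ℂ, F →L[ℂ] F) ω ρ)
    (hV : IsRealForm V) (hGV : ∀ a ∈ G, ∀ v ∈ V, ρ a v ∈ V) {h : InnerProductSpace.Core ℂ F}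
    (hh : IsInvariantUnder h ρ U) : IsInvariantUnder (addConjugate hV h) ρ U := by
  obtain ⟨hg, hu, hc⟩ := hgu
  have htr := trace_mul_eq_zero hρ hκ
  have hconjG : ∀ a ∈ G, conjugateOperator hV (ρ a : Module.End ℂ F) = ρ a := fun a ha =>
    conjugateOperator_eq_of_preserves hV (hGV a ha)
  have hgV : ∀ X ∈ g, conjugateOperator hV (operatorRep ρ X) = operatorRep ρ X := fun X hX =>
    ((hG.mem_iff X).1 hX).conjugateOperator_eq hρ hV hconjG
  have hs : ∀ Y ∈ operatorAlgebra (E := E) ρ, conjugateOperator hV Y ∈ operatorAlgebra (E := E) ρ := by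
    rintro _ ⟨X, rfl⟩
    exact ⟨_, (conjugateOperator_eq_conjugation hg hV hgV X).symm⟩
  intro a ha x y
  obtain ⟨b, hb, c, hc', rfl⟩ := hG.exists_mul a
  have : IsTopologicalGroup GC := topologicalGroup_of_lieGroup 𝓘(ℂ, E) ω
  have hcinv : c⁻¹ ∈ connectedComponent (1 : GC) :=
    (Subgroup.connectedComponentOfOne GC).inv_mem hc'
  have hB : IsUnimodularOver (operatorAlgebra (E := E) ρ)
      (conjugateOperator hV (ρ (b * c) : Module.End ℂ F) * (ρ (b * c)⁻¹ : Module.End ℂ F)) := by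
    -- As `ρ b` commutes with `σ`, the operator in question is `ρ b (σ ρ(c) σ ρ(c)⁻¹) ρ b⁻¹`, a
    -- conjugate of a product of two unimodular operators.
    have h1 := ((isUnimodularOver_of_mem_connectedComponent hρ htr hc').conjugateOperator hV hs).mul
      (isUnimodularOver_of_mem_connectedComponent hρ htr hcinv)
    have h2 := h1.conj (map_mul_map_inv b) (map_inv_mul_map b) (conj_mem_operatorAlgebra hρ b)
    have e1 : (ρ (b * c) : Module.End ℂ F) = (ρ b : Module.End ℂ F) * (ρ c : Module.End ℂ F) := by
      rw [map_mul]
      rfl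
    have e2 : (ρ (b * c)⁻¹ : Module.End ℂ F) =
        (ρ c⁻¹ : Module.End ℂ F) * (ρ b⁻¹ : Module.End ℂ F) := by
      rw [mul_inv_rev, map_mul]
      rfl
    rw [e1, e2, conjugateOperator_mul, hconjG b hb]
    simpa only [mul_assoc] using h2
  have key := inner_conjugateOperator h hu hg hV
    (fun X hX => ((hU.mem_iff X).1 hX).skew hρ hh) htr hgV hc (map_mul_map_inv (b * c))
    (map_inv_mul_map (b * c)) (hh _ ha) (conj_mem_operatorAlgebra hρ _)
    (conj_mem_operatorAlgebra' hρ _) hB (conjugation hV x) (conjugation hV y)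
  rw [conjugateOperator_apply, conjugateOperator_apply, conjugation_conjugation,
    conjugation_conjugation] at key
  change h.inner _ _ + starRingEnd ℂ (h.inner _ _) = h.inner _ _ + starRingEnd ℂ (h.inner _ _)
  rw [hh _ ha]
  exact congrArg (fun z => h.inner x y + starRingEnd ℂ z) key

theorem minimalVectors_subset (hG : IsGroupRealForm G g) (hU : IsGroupRealForm U u)
    (hκ : ∀ x : GroupLieAlgebra 𝓘(ℂ, E) GC,
      (∀ y, killingForm ℂ (GroupLieAlgebra 𝓘(ℂ, E) GC) x y = 0) → x = 0)
    (hgu : AreCompatible g u) (hρ : ContMDiff 𝓘(ℂ, E) 𝓘(ℂ, F →L[ℂ] F) ω ρ)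
    (hV : IsRealForm V) (hGV : ∀ a ∈ G, ∀ v ∈ V, ρ a v ∈ V) {h : InnerProductSpace.Core ℂ F}
    (hh : IsInvariantUnder h ρ U) (hreal : IsRealOn h V) :
    minimalVectors h ρ G V ⊆ minimalVectors h ρ ⊤ ⊤ := by
  obtain ⟨hg, hu, hc⟩ := hgu
  have htr := trace_mul_eq_zero hρ hκ
  intro v hv
  refine ⟨Submodule.mem_top, fun a _ => ?_⟩
  obtain ⟨b, hb, c, hc', rfl⟩ := hU.exists_mul a
  have e : ρ (b * c) v = ρ b (ρ c v) := by
    rw [map_mul]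
    rfl
  rw [e, hh b hb]
  exact inner_le_of_critical (V := V) h hu hg (fun X hX => ((hU.mem_iff X).1 hX).skew hρ hh)
    (commutator_mem_operatorAlgebra hρ) htr hc (map_mul_map_inv c) (map_inv_mul_map c)
    (isUnimodularOver_of_mem_connectedComponent hρ htr hc') (conj_mem_operatorAlgebra hρ c)
    (conj_mem_operatorAlgebra' hρ c) hreal hv.1
    (fun X hX => mem_of_conjugation_eq hV (by
      have := LinearMap.congr_fun (((hG.mem_iff X).1 hX).conjugateOperator_eq hρ hV
        fun a ha => conjugateOperator_eq_of_preserves hV (hGV a ha)) v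
      rwa [conjugateOperator_apply, conjugation_of_mem hV hv.1] at this))
    (fun X hX => ((hG.mem_iff X).1 hX).re_inner_eq_zero hρ hv)

end Representation

end CompatibleForms

end

/-! ### Assembly -/

theorem mainTheorem8
    {E : Type*} [NormedAddCommGroup E] [NormedSpace ℂ E] [FiniteDimensional ℂ E]
    {GC : Type*} [TopologicalSpace GC] [T2Space GC] [ChartedSpace E GC] [Group GC]
    [LieGroup 𝓘(ℂ, E) ω GC]
    {F : Type*} [NormedAddCommGroup F] [NormedSpace ℂ F] [FiniteDimensional ℂ F]
    (G G' U : Subgroup GC) (g g' u : Submodule ℝ (GroupLieAlgebra 𝓘(ℂ, E) GC))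
    (hG : CompatibleForms.IsGroupRealForm G g)
    (hG' : CompatibleForms.IsGroupRealForm G' g')
    (hU : CompatibleForms.IsGroupRealForm U u)
    (hUc : IsCompact (U : Set GC))
    (hT : CompatibleForms.IsCompatibleTriple
      (-killingForm ℂ (GroupLieAlgebra 𝓘(ℂ, E) GC)) g g' u)
    (ρ : GC →* (F →L[ℂ] F)) (hρ : ContMDiff 𝓘(ℂ, E) 𝓘(ℂ, F →L[ℂ] F) ω ρ)
    (V V' : Submodule ℝ F) (hV : CompatibleForms.AreCompatible V V')
    (hGV : ∀ a ∈ G, ∀ v ∈ V, ρ a v ∈ V)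
    (hGV' : ∀ a ∈ G', ∀ v ∈ V', ρ a v ∈ V') :
    (∃ h : InnerProductSpace.Core ℂ F, CompatibleForms.IsInvariantUnder h ρ U ∧
      CompatibleForms.IsRealOn h V ∧ CompatibleForms.IsRealOn h V') ∧
    ∀ h : InnerProductSpace.Core ℂ F, CompatibleForms.IsInvariantUnder h ρ U →
      CompatibleForms.IsRealOn h V → CompatibleForms.IsRealOn h V' →
      CompatibleForms.minimalVectors h ρ G V ⊆ CompatibleForms.minimalVectors h ρ ⊤ ⊤ ∧
      CompatibleForms.minimalVectors h ρ G' V' ⊆ CompatibleForms.minimalVectors h ρ ⊤ ⊤ := by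
  have : IsTopologicalGroup GC := topologicalGroup_of_lieGroup 𝓘(ℂ, E) ω
  have hκ := CompatibleForms.killingForm_nondegenerate hU.isRealForm hT.realSlice_compact
    hT.euclidean
  obtain ⟨hVf, hVf', hVc⟩ := hV
  refine ⟨?_, fun h hh hreal hreal' => ⟨?_, ?_⟩⟩
  · have : CompactSpace U := isCompact_iff_compactSpace.1 hUc
    obtain ⟨h₀, hh₀⟩ := CompatibleForms.exists_invariant_core (ρ.comp U.subtype)
      (hρ.continuous.comp continuous_subtype_val)
    have h₀U : CompatibleForms.IsInvariantUnder h₀ ρ U := fun k hk x y => hh₀ ⟨k, hk⟩ x y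
    have h₁U := h₀U.addConjugate hG hU hκ hT.compatible_left hρ hVf hGV
    -- The outer sum creates reality on `V'`; it keeps the reality on `V` gained by the inner sum
    -- because the two conjugations commute.
    refine ⟨CompatibleForms.addConjugate hVf' (CompatibleForms.addConjugate hVf h₀),
      h₁U.addConjugate hG' hU hκ hT.compatible_right hρ hVf' hGV', ?_, ?_⟩
    · exact CompatibleForms.isRealOn_of_inner_conjugation hVf
        (CompatibleForms.addConjugate_inner_conjugation_of_commute hVf hVf' hVc _
          (CompatibleForms.addConjugate_inner_conjugation hVf h₀))
    · exact CompatibleForms.isRealOn_of_inner_conjugation hVf'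
        (CompatibleForms.addConjugate_inner_conjugation hVf' _)
  · exact CompatibleForms.minimalVectors_subset hG hU hκ hT.compatible_left hρ hVf hGV hh hreal
  · exact CompatibleForms.minimalVectors_subset hG' hU hκ hT.compatible_right hρ hVf' hGV' hh hreal'
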